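/- Let $0<M_1\le M_2$. There are constants $c>0$ and $C>0$, depending only on $M_1$ and $M_2$, such that the following holds for all integers $p,k,n,L$ with $1\le k<p/2$, $n\ge 1$, $L\ge 1$, all layer widths $d^{(1)},d^{(2)},\dots\ge 1$ and all $\varepsilon\ge 0$ with $$2^L\cdot\frac{r}{n}+\varepsilon^2\le c,\qquad r:=2k+2k\log\frac{p}{2k}.$$ Let $\Theta_2(k)$ be the set of positive semidefinite matrices $\Sigma\in\mathbb R^{p\times p}$ with $M_1\le\|\Sigma\|_2\le M_2$ (spectral norm) for which there is a set $I\subseteq\{1,\dots,p\}$ with $|I|\le k$ such that $\Sigma-\mathrm{diag}(\Sigma)$ has zero $(i,j)$ entry whenever $i\notin I$ or $j\notin I$. Let $\Sigma^*\in\Theta_2(k)$, let $P$ be a probability measure on $\mathbb R^p$ with Wasserstein-1 distance (for the Euclidean norm) $W_1(P,\mathcal N(0,\Sigma^*))\le\varepsilon$, and let $X_1,\dots,X_n$ be i.i.d. with law $P$ and empirical distribution $P_n$. Put $B=1/M_1$ and let $\mathcal D=\mathcal D_{sp}(B,L,2k)$ be the following class of $L$-layer neural networks. With the sigmoid $\sigma(u)=1/(1+e^{-u})$,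 the nodes of the first layer form $\mathcal D^{(1)}=\{x\mapsto\sigma(w^Tx+b):\|w\|_2\le B,\ \|w\|_0\le 2k,\ b\in\mathbb R\}$; for $1\le l<L-1$, $\mathcal D^{(l+1)}=\{x\mapsto\max(0,\sum_{i=1}^{d^{(l)}}w_if_i(x)):\sum_i|w_i|\le1,\ f_i\in\mathcal D^{(l)}\}$; and $\mathcal D=\{\sum_{i=1}^{d^{(L-1)}}w_if_i:\sum_i|w_i|\le1,\ f_i\in\mathcal D^{(L-1)}\}$ (for $L=1$, $\mathcal D=\mathcal D^{(1)}$). Let $\widehat\Sigma$ be the W-GAN estimator $$\widehat\Sigma\in\operatorname*{argmin}_{\Sigma\in\Theta_2(k)}\ \sup_{f\in\mathcal D}\left\{\mathbb E_{P_n}f(X)-\mathbb E_{\mathcal N(0,\Sigma)}f(X)\right\}.$$ Then, with probability at least $1-e^{-(r+n\varepsilon^2)}$, $$\|\widehat\Sigma-\Sigma^*\|_2\le C\left(2^L\sqrt{\frac{2k+2k\log\frac{p}{2k}}{n}}\ \vee\ \varepsilon\right).$$ -/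

import Mathlib

open MeasureTheory ProbabilityTheory
open scoped ENNReal

noncomputable section

namespace WGAN

/-- The Euclidean space `ℝ^p`. -/
abbrev Vec (p : ℕ) : Type := EuclideanSpace ℝ (Fin p)

/-- The Wasserstein distance of order one between two measures on `ℝ^p`: the infimum over all
couplings of the expected Euclidean distance. -/
def W1 {p : ℕ} (P Q : Measure (Vec p)) : ℝ≥0∞ :=
  ⨅ π ∈ {π : Measure (Vec p × Vec p) | π.fst = P ∧ π.snd = Q}, ∫⁻ z, edist z.1 z.2 ∂π

/-- The spectral norm (operator norm with respect to the Euclidean norm) of a square matrix. -/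
def specNorm {p : ℕ} (A : Matrix (Fin p) (Fin p) ℝ) : ℝ :=
  ‖Matrix.toEuclideanCLM (n := Fin p) (𝕜 := ℝ) A‖

/-- The matrices supported on `I × I` for some index set `I` with at most `k` elements. -/
def blockSparse (p k : ℕ) : Set (Matrix (Fin p) (Fin p) ℝ) :=
  {G | ∃ I : Finset (Fin p), I.card ≤ k ∧ ∀ i j, (i ∉ I ∨ j ∉ I) → G i j = 0}

/-- The positive semidefinite matrices whose off-diagonal part is supported on a `k × k` block. -/
def sparseCov (p k : ℕ) : Set (Matrix (Fin p) (Fin p) ℝ) :=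
  {S | S.PosSemidef ∧ S - Matrix.diagonal S.diag ∈ blockSparse p k}

/-- The parameter space: sparse covariance matrices with spectral norm in `[M₁, M₂]`. -/
def paramSpace (p k : ℕ) (M₁ M₂ : ℝ) : Set (Matrix (Fin p) (Fin p) ℝ) :=
  {S | S ∈ sparseCov p k ∧ M₁ ≤ specNorm S ∧ specNorm S ≤ M₂}

/-- First-layer nodes: `x ↦ σ(wᵀx + b)` with `‖w‖₂ ≤ B` and `‖w‖₀ ≤ s`. -/
def firstLayer (p : ℕ) (B : ℝ) (s : ℕ) : Set (Vec p → ℝ) :=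
  {f | ∃ (w : Vec p) (b : ℝ), ‖w‖ ≤ B ∧ {i | w i ≠ 0}.ncard ≤ s ∧
    f = fun x => Real.sigmoid (inner ℝ w x + b)}

/-- Combinations `∑ wᵢ fᵢ` of `m` functions from `F` with `∑ |wᵢ| ≤ 1`. -/
def l1Combinations {p : ℕ} (m : ℕ) (F : Set (Vec p → ℝ)) : Set (Vec p → ℝ) :=
  {h | ∃ (w : Fin m → ℝ) (f : Fin m → Vec p → ℝ), (∀ i, f i ∈ F) ∧ ∑ i, |w i| ≤ 1 ∧
    h = fun x => ∑ i, w i * f i x}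

/-- `layer p B s d l` is the class of nodes in layer `l + 1`, where `d j` is the number of nodes
in layer `j` (layers are numbered from one). -/
def layer (p : ℕ) (B : ℝ) (s : ℕ) (d : ℕ → ℕ) : ℕ → Set (Vec p → ℝ)
  | 0 => firstLayer p B s
  | l + 1 => {f | ∃ h ∈ l1Combinations (d (l + 1)) (layer p B s d l), f = fun x => max (h x) 0}

/-- The sparse network class with `L` layers: for `L ≥ 2`, `ℓ¹`-bounded linear combinations of
the nodes in layer `L - 1`; a one-layer network is a first-layer node (the value at `L = 0` is
irrelevant). -/
def sparseNet (p : ℕ) (B : ℝ) (L s : ℕ) (d : ℕ → ℕ) : Set (Vec p → ℝ) :=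
  match L with
  | 0 => firstLayer p B s
  | 1 => firstLayer p B s
  | l + 2 => l1Combinations (d (l + 1)) (layer p B s d l)

/-- The W-GAN objective `sup_{f ∈ D} (E_{P_n} f - E_{N(0, S)} f)`, where `P_n` is the empirical
distribution of the sample `x`. -/
def ganObjective {p n : ℕ} (D : Set (Vec p → ℝ)) (x : Fin n → Vec p)
    (S : Matrix (Fin p) (Fin p) ℝ) : ℝ :=
  sSup ((fun f : Vec p → ℝ =>
    (n : ℝ)⁻¹ * ∑ i, f (x i) - ∫ y, f y ∂(multivariateGaussian 0 S)) '' D)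

/-- `S` is a W-GAN estimate from the sample `x`: a minimizer over the parameter space `Θ` of the
W-GAN objective. -/
def IsWGANEstimate {p n : ℕ} (D : Set (Vec p → ℝ)) (Θ : Set (Matrix (Fin p) (Fin p) ℝ))
    (x : Fin n → Vec p) (S : Matrix (Fin p) (Fin p) ℝ) : Prop :=
  S ∈ Θ ∧ ∀ T ∈ Θ, ganObjective D x S ≤ ganObjective D x T

/-- The complexity term `2k + 2k log(p / (2k))`. -/
def complexity (p k : ℕ) : ℝ :=
  2 * (k : ℝ) + 2 * (k : ℝ) * Real.log ((p : ℝ) / (2 * (k : ℝ)))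

end WGAN

end

noncomputable section

namespace WGAN

/-! The error of the estimator is bounded by a deterministic multiple of the uniform deviation `dev`
of the sample means over the network class from their values under the target Gaussian. The
deviation is then bounded with high probability.

Deterministic half. Minimality gives, for every network `f`, a discrepancy between the fitted and
the true Gaussian mean of at most twice the deviation (`IsWGANEstimate.integral_sub_le`). A single
first-layer node with bias 1 already detects a change of variance: the Gaussian mean of `σ(aZ + 1)`
decreases in `a ^ 2` at a rate bounded below on bounded sets (`sigmoid_separation`). The spectral
norm of the difference of two sparse covariances is reached by the quadratic form along a unit
vector with at most `2k` nonzero entries (`exists_sparse_direction`), and such nodes pass unchanged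
through all layers (`firstLayer_subset_sparseNet`).

Stochastic half. Bounded differences concentrate the deviation around its mean
(`Regular.dev_concentration`). Since all networks are `B`-Lipschitz, coupling moves the mean from
`P` to the Gaussian at cost `B * ε` (`Regular.integral_dev_le_of_W1`). Symmetrization
(`Regular.integral_dev_le`) leaves a Rademacher average. Contraction peels off the layers, with a
factor 2 for each rectification (`rad_sparseNet_le`). In the first layer the bias ranges over all
reals, so contraction alone does not remove it; in the Fourier representation of the sigmoid the
bias is a mere phase, and its supremum disappears (`radAvg_sigmoid_le`). What remains is a supremum
of sparse linear functions of a Gaussian vector, bounded by exponential moments over all supports of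
size `2k` (`exists_majorant_radAvg_linear`). This is the origin of the complexity term. -/

/-- The sign `±1` encoded by a boolean. -/
def sgn (b : Bool) : ℝ := if b then 1 else -1

lemma sgn_true : sgn true = 1 := rfl

lemma sgn_false : sgn false = -1 := by simp [sgn]

lemma sgn_not (b : Bool) : sgn (!b) = -sgn b := by cases b <;> simp [sgn]

lemma abs_sgn (b : Bool) : |sgn b| = 1 := by cases b <;> simp [sgn]

lemma sgn_mul_self (b : Bool) : sgn b * sgn b = 1 := by cases b <;> simp [sgn]

/-- Boundedness of a real-valued family. -/
def Bdd {ι : Type*} (u : ι → ℝ) : Prop := ∃ C, ∀ t, |u t| ≤ C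

/-! ### Calculus of bounded families. -/

section Bdd

variable {ι κ : Type*}

lemma Bdd.add {u v : ι → ℝ} (hu : Bdd u) (hv : Bdd v) : Bdd (fun t => u t + v t) := by
  obtain ⟨C, hC⟩ := hu
  obtain ⟨D, hD⟩ := hv
  exact ⟨C + D, fun t => (abs_add_le _ _).trans (add_le_add (hC t) (hD t))⟩

lemma Bdd.const_mul {u : ι → ℝ} (hu : Bdd u) (c : ℝ) : Bdd (fun t => c * u t) := by
  obtain ⟨C, hC⟩ := hu
  exact ⟨|c| * C, fun t => by rw [abs_mul]; exact mul_le_mul_of_nonneg_left (hC t) (abs_nonneg c)⟩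

lemma Bdd.neg {u : ι → ℝ} (hu : Bdd u) : Bdd (fun t => -u t) := by
  obtain ⟨C, hC⟩ := hu
  exact ⟨C, fun t => by rw [abs_neg]; exact hC t⟩

lemma Bdd.abs {u : ι → ℝ} (hu : Bdd u) : Bdd (fun t => |u t|) := by
  obtain ⟨C, hC⟩ := hu
  exact ⟨C, fun t => by rw [abs_abs]; exact hC t⟩

lemma Bdd.zero : Bdd (fun _ : ι => (0 : ℝ)) := ⟨0, fun _ => by simp⟩

lemma Bdd.sum {s : Finset κ} {u : κ → ι → ℝ} (hu : ∀ k, Bdd (u k)) :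
    Bdd (fun t => ∑ k ∈ s, u k t) := by
  choose C hC using hu
  exact ⟨∑ k ∈ s, C k, fun t => (Finset.abs_sum_le_sum_abs _ _).trans
    (Finset.sum_le_sum fun k _ => hC k t)⟩

lemma Bdd.bddAbove {u : ι → ℝ} (hu : Bdd u) : BddAbove (Set.range u) := by
  obtain ⟨C, hC⟩ := hu
  exact ⟨C, by rintro _ ⟨t, rfl⟩; exact (le_abs_self _).trans (hC t)⟩

lemma Bdd.le_ciSup {u : ι → ℝ} (hu : Bdd u) (t : ι) : u t ≤ ⨆ t, u t :=
  _root_.le_ciSup hu.bddAbove t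

lemma Bdd.option {u : ι → ℝ} (hu : Bdd u) : Bdd (fun t : Option ι => t.elim 0 u) := by
  obtain ⟨C, hC⟩ := hu
  refine ⟨max C 0, fun t => ?_⟩
  cases t with
  | none => simp
  | some t => exact (hC t).trans (le_max_left _ _)

end Bdd

/-! ### Rademacher averages and the contraction principle. -/

section Contraction

variable {ι : Type*}

lemma signSum_bdd {n : ℕ} {u : Fin n → ι → ℝ} (hu : ∀ i, Bdd (u i)) (ξ : Fin n → Bool) :
    Bdd (fun t => ∑ i, sgn (ξ i) * u i t) :=
  Bdd.sum fun i => (hu i).const_mul _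

/-- For `s` in the first supremum and `t` in the second, the left side is at most `A s + A t + |u s
- u t|`. According to the sign of `u s - u t`, this is a sum of one value from each right-hand
supremum, with `s` and `t` exchanged if necessary. -/
lemma contraction_step [Nonempty ι] {A u v : ι → ℝ} (hA : Bdd A) (hu : Bdd u)
    (h : ∀ s t, |v s - v t| ≤ |u s - u t|) :
    (⨆ t, (A t + v t)) + (⨆ t, (A t - v t)) ≤ (⨆ t, (A t + u t)) + (⨆ t, (A t - u t)) := by
  have h1 : Bdd (fun t => A t + u t) := hA.add hu
  have h2 : Bdd (fun t => A t - u t) := by simpa only [sub_eq_add_neg] using hA.add hu.neg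
  refine ciSup_add_ciSup_le fun s t => ?_
  have e1 := h1.le_ciSup s
  have e2 := h1.le_ciSup t
  have e3 := h2.le_ciSup s
  have e4 := h2.le_ciSup t
  have := (le_abs_self _).trans (h s t)
  rcases abs_cases (u s - u t) with ⟨h', _⟩ | ⟨h', _⟩ <;> linarith

lemma sum_bool_fun_succ {n : ℕ} (g : (Fin (n + 1) → Bool) → ℝ) :
    ∑ ξ, g ξ = ∑ ξ : Fin n → Bool, (g (Fin.cons true ξ) + g (Fin.cons false ξ)) := by
  rw [← (Fin.consEquiv (fun _ : Fin (n + 1) => Bool)).sum_comp, Fintype.sum_prod_type,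
    Finset.sum_comm]
  simp [Fin.consEquiv]

/-- The comparison principle behind the Ledoux-Talagrand contraction inequality. -/
theorem sum_signs_iSup_le [Nonempty ι] {n : ℕ} (a : ι → ℝ) (u v : Fin n → ι → ℝ) (ha : Bdd a)
    (hu : ∀ i, Bdd (u i)) (hv : ∀ i, Bdd (v i))
    (h : ∀ i s t, |v i s - v i t| ≤ |u i s - u i t|) :
    ∑ ξ : Fin n → Bool, ⨆ t, (a t + ∑ i, sgn (ξ i) * v i t) ≤
      ∑ ξ : Fin n → Bool, ⨆ t, (a t + ∑ i, sgn (ξ i) * u i t) := by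
  induction n generalizing a with
  | zero => simp
  | succ n ih =>
    rw [sum_bool_fun_succ, sum_bool_fun_succ]
    simp only [Fin.sum_univ_succ, Fin.cons_zero, Fin.cons_succ, sgn_true, sgn_false]
    -- With the first sign frozen to `c`, the first summand is absorbed into the offset `a`; this is
    -- why the induction carries a general offset.
    have key : ∀ c : ℝ, ∑ ξ : Fin n → Bool,
        ⨆ t, (a t + (c * v 0 t + ∑ i, sgn (ξ i) * v i.succ t)) ≤
        ∑ ξ : Fin n → Bool, ⨆ t, (a t + (c * v 0 t + ∑ i, sgn (ξ i) * u i.succ t)) := by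
      intro c
      simpa only [add_assoc] using ih (fun t => a t + c * v 0 t) (fun i => u i.succ)
        (fun i => v i.succ) (ha.add ((hv 0).const_mul c)) (fun i => hu _) (fun i => hv _)
        (fun i => h _)
    rw [Finset.sum_add_distrib]
    refine (add_le_add (key 1) (key (-1))).trans ?_
    rw [← Finset.sum_add_distrib]
    refine Finset.sum_le_sum fun ξ _ => ?_
    have := contraction_step (A := fun t => a t + ∑ i, sgn (ξ i) * u i.succ t) (u := u 0)
      (v := v 0) (ha.add (signSum_bdd (fun i => hu _) ξ)) (hu 0) (h 0)
    convert! this using 4 <;> ring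

lemma sum_bool_fun_not {n : ℕ} (g : (Fin n → Bool) → ℝ) :
    ∑ ξ : Fin n → Bool, g (fun i => !ξ i) = ∑ ξ, g ξ :=
  (Equiv.piCongrRight fun _ : Fin n => Equiv.boolNot).sum_comp g

/-- The Rademacher average `E_ξ sup_t |∑ ξᵢ uᵢ(t)|` over independent uniform signs `ξ`. -/
def radAvg {n : ℕ} (u : Fin n → ι → ℝ) : ℝ :=
  (2 ^ n : ℝ)⁻¹ * ∑ ξ : Fin n → Bool, ⨆ t, |∑ i, sgn (ξ i) * u i t|

lemma radAvg_nonneg {n : ℕ} (u : Fin n → ι → ℝ) : 0 ≤ radAvg u :=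
  mul_nonneg (by positivity) (Finset.sum_nonneg fun _ _ => Real.iSup_nonneg fun _ => abs_nonneg _)

/-- Contraction inequality for Rademacher averages with absolute values. -/
theorem radAvg_contraction [Nonempty ι] {n : ℕ} {u v : Fin n → ι → ℝ} (hu : ∀ i, Bdd (u i))
    (hle : ∀ i t, |v i t| ≤ |u i t|) (h : ∀ i s t, |v i s - v i t| ≤ |u i s - u i t|) :
    radAvg v ≤ 2 * radAvg u := by
  have hv : ∀ i, Bdd (v i) := fun i => by
    obtain ⟨C, hC⟩ := hu i
    exact ⟨C, fun t => (hle i t).trans (hC t)⟩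
  -- Adjoining an index with value zero makes all signed suprema nonnegative, so the supremum of
  -- absolute values is at most the sum of those for `ξ` and for the flipped signs. The bound `hle`
  -- is the increment condition against the new index.
  let u' : Fin n → Option ι → ℝ := fun i t => t.elim 0 (u i)
  let v' : Fin n → Option ι → ℝ := fun i t => t.elim 0 (v i)
  have hu' : ∀ i, Bdd (u' i) := fun i => (hu i).option
  have hv' : ∀ i, Bdd (v' i) := fun i => (hv i).option
  have hmain := sum_signs_iSup_le (fun _ : Option ι => (0 : ℝ)) u' v' Bdd.zero hu' hv'
    (by
      intro i s t
      cases s <;> cases t <;> simp [u', v', hle, h])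
  simp only [zero_add] at hmain
  set V : (Fin n → Bool) → ℝ := fun ξ => ⨆ t, ∑ i, sgn (ξ i) * v' i t with hV
  have hV0 : ∀ ξ, 0 ≤ V ξ := fun ξ => by
    have := (signSum_bdd hv' ξ).le_ciSup none
    simpa [v'] using this
  have h1 : ∀ ξ : Fin n → Bool, ⨆ t, |∑ i, sgn (ξ i) * v i t| ≤ V ξ + V (fun i => !ξ i) := by
    intro ξ
    refine ciSup_le fun t => ?_
    have e1 := (signSum_bdd hv' ξ).le_ciSup (some t)
    have e2 := (signSum_bdd hv' (fun i => !ξ i)).le_ciSup (some t)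
    simp only [v', Option.elim_some, sgn_not, neg_mul, Finset.sum_neg_distrib] at e1 e2
    have e3 := hV0 ξ
    have e4 := hV0 (fun i => !ξ i)
    simp only [hV, v', sgn_not, neg_mul, Finset.sum_neg_distrib] at e3 e4 ⊢
    rw [abs_le]
    constructor <;> linarith
  have h2 : ∀ ξ : Fin n → Bool, ⨆ t, ∑ i, sgn (ξ i) * u' i t ≤ ⨆ t, |∑ i, sgn (ξ i) * u i t| := by
    intro ξ
    refine ciSup_le fun t => ?_
    cases t with
    | none => simpa [u'] using Real.iSup_nonneg fun _ => abs_nonneg _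
    | some t => exact (le_abs_self _).trans ((signSum_bdd hu ξ).abs.le_ciSup t)
  have h3 : ∑ ξ : Fin n → Bool, ⨆ t, |∑ i, sgn (ξ i) * v i t| ≤
      2 * ∑ ξ : Fin n → Bool, ⨆ t, |∑ i, sgn (ξ i) * u i t| := by
    calc _ ≤ ∑ ξ, (V ξ + V (fun i => !ξ i)) := Finset.sum_le_sum fun ξ _ => h1 ξ
      _ = 2 * ∑ ξ, V ξ := by rw [Finset.sum_add_distrib, sum_bool_fun_not V]; ring
      _ ≤ _ := by
        refine mul_le_mul_of_nonneg_left (hmain.trans ?_) (by norm_num)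
        exact Finset.sum_le_sum fun ξ _ => h2 ξ
  unfold radAvg
  rw [mul_left_comm]
  exact mul_le_mul_of_nonneg_left h3 (by positivity)

/-- Comparison of Rademacher averages from a comparison for each choice of signs. -/
lemma radAvg_mono {κ : Type*} {n : ℕ} {u : Fin n → ι → ℝ} {v : Fin n → κ → ℝ}
    (h : ∀ ξ : Fin n → Bool, ⨆ t, |∑ i, sgn (ξ i) * u i t| ≤ ⨆ t, |∑ i, sgn (ξ i) * v i t|) :
    radAvg u ≤ radAvg v :=
  mul_le_mul_of_nonneg_left (Finset.sum_le_sum fun ξ _ => h ξ) (by positivity)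

end Contraction

/-! ### Rademacher averages of function classes. -/

section Class

variable {E : Type*}

/-- The Rademacher average of a function class at the points `x`. -/
def rad {n : ℕ} (F : Set (E → ℝ)) (x : Fin n → E) : ℝ :=
  radAvg (fun i (f : F) => f.1 (x i))

lemma rad_nonneg {n : ℕ} (F : Set (E → ℝ)) (x : Fin n → E) : 0 ≤ rad F x := radAvg_nonneg _

/-- All members of the class are bounded by one in absolute value. -/
def UnitBounded (F : Set (E → ℝ)) : Prop := ∀ f ∈ F, ∀ x, |f x| ≤ 1

lemma UnitBounded.bdd {F : Set (E → ℝ)} (hF : UnitBounded F) (x : E) :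
    Bdd (fun f : F => f.1 x) := ⟨1, fun f => hF f.1 f.2 x⟩

/-- Rectification at most doubles the Rademacher average. -/
lemma rad_relu_le {n : ℕ} {H : Set (E → ℝ)} (hne : H.Nonempty) (hH : UnitBounded H)
    (x : Fin n → E) :
    rad {f | ∃ h ∈ H, f = fun x => max (h x) 0} x ≤ 2 * rad H x := by
  have : Nonempty H := hne.to_subtype
  have h1 : rad {f | ∃ h ∈ H, f = fun x => max (h x) 0} x ≤
      radAvg (fun i (h : H) => max (h.1 (x i)) 0) := by
    refine radAvg_mono fun ξ => ?_
    refine Real.iSup_le ?_ (Real.iSup_nonneg fun _ => abs_nonneg _)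
    rintro ⟨f, h, hh, rfl⟩
    refine Bdd.le_ciSup (u := fun h : H => |∑ i, sgn (ξ i) * max (h.1 (x i)) 0|) ?_ ⟨h, hh⟩
    refine (signSum_bdd (u := fun i (h : H) => max (h.1 (x i)) 0) (fun i => ⟨1, fun h => ?_⟩) ξ).abs
    exact (abs_max_le_max_abs_abs).trans (by simpa using hH h.1 h.2 (x i))
  refine h1.trans (radAvg_contraction (fun i => hH.bdd (x i)) ?_ ?_)
  · intro i t
    exact (abs_max_le_max_abs_abs).trans (by simp)
  · intro i s t
    exact abs_max_sub_max_le_abs _ _ _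

end Class

/-! ### Propagation of bounds through the layers. -/

section Network

variable {p : ℕ}

lemma abs_sum_mul_le {m : ℕ} {w a : Fin m → ℝ} {C : ℝ} (hC : 0 ≤ C) (hw : ∑ i, |w i| ≤ 1)
    (ha : ∀ i, |a i| ≤ C) : |∑ i, w i * a i| ≤ C :=
  calc |∑ i, w i * a i| ≤ ∑ i, |w i| * |a i| := by
        simpa only [abs_mul] using Finset.abs_sum_le_sum_abs (fun i => w i * a i) Finset.univ
    _ ≤ ∑ i, |w i| * C :=
        Finset.sum_le_sum fun i _ => mul_le_mul_of_nonneg_left (ha i) (abs_nonneg _)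
    _ = (∑ i, |w i|) * C := by rw [Finset.sum_mul]
    _ ≤ C := mul_le_of_le_one_left hC hw

/-- Passing to `ℓ¹`-combinations does not increase the Rademacher average. -/
lemma rad_l1Combinations_le {n : ℕ} (m : ℕ) {F : Set (Vec p → ℝ)} (hF : UnitBounded F)
    (x : Fin n → Vec p) : rad (l1Combinations m F) x ≤ rad F x := by
  refine radAvg_mono fun ξ => ?_
  refine Real.iSup_le ?_ (Real.iSup_nonneg fun _ => abs_nonneg _)
  rintro ⟨h, w, f, hf, hw, rfl⟩
  have : ∑ i, sgn (ξ i) * ∑ j, w j * f j (x i) = ∑ j, w j * ∑ i, sgn (ξ i) * f j (x i) := by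
    simp only [Finset.mul_sum]
    rw [Finset.sum_comm]
    exact Finset.sum_congr rfl fun _ _ => Finset.sum_congr rfl fun _ _ => by ring
  simp only [this]
  refine abs_sum_mul_le (Real.iSup_nonneg fun _ => abs_nonneg _) hw fun j => ?_
  exact (signSum_bdd (u := fun i (f : F) => f.1 (x i)) (fun i => hF.bdd (x i)) ξ).abs.le_ciSup
    ⟨f j, hf j⟩

/-- Unit bound and Lipschitz bound for a class of functions on `ℝ^p`. -/
structure Regular (B : ℝ) (F : Set (Vec p → ℝ)) : Prop where
  bound : UnitBounded F
  lip : ∀ f ∈ F, ∀ x y, |f x - f y| ≤ B * ‖x - y‖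

lemma Regular.continuous {B : ℝ} {F : Set (Vec p → ℝ)} (hF : Regular B F) {f : Vec p → ℝ}
    (hf : f ∈ F) : Continuous f := by
  refine (LipschitzWith.of_dist_le_mul (K := B.toNNReal) fun x y => ?_).continuous
  rw [Real.dist_eq, dist_eq_norm, Real.coe_toNNReal']
  exact (hF.lip f hf x y).trans (mul_le_mul_of_nonneg_right (le_max_left _ _) (norm_nonneg _))

lemma Regular.l1Combinations {B : ℝ} (hB : 0 ≤ B) {F : Set (Vec p → ℝ)} (hF : Regular B F)
    (m : ℕ) : Regular B (l1Combinations m F) := by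
  constructor
  · rintro _ ⟨w, f, hf, hw, rfl⟩ x
    exact abs_sum_mul_le zero_le_one hw fun i => hF.bound _ (hf i) x
  · rintro _ ⟨w, f, hf, hw, rfl⟩ x y
    simp only [← Finset.sum_sub_distrib, ← mul_sub]
    exact abs_sum_mul_le (by positivity) hw fun i => hF.lip _ (hf i) x y

lemma Regular.relu {B : ℝ} {F : Set (Vec p → ℝ)} (hF : Regular B F) :
    Regular B {f | ∃ h ∈ F, f = fun x => max (h x) 0} := by
  constructor
  · rintro _ ⟨h, hh, rfl⟩ x
    exact (abs_max_le_max_abs_abs).trans (by simpa using hF.bound h hh x)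
  · rintro _ ⟨h, hh, rfl⟩ x y
    exact (abs_max_sub_max_le_abs _ _ _).trans (hF.lip h hh x y)

lemma abs_sigmoid_sub_le (a b : ℝ) : |Real.sigmoid a - Real.sigmoid b| ≤ |a - b| := by
  have := Convex.norm_image_sub_le_of_norm_deriv_le (f := Real.sigmoid) (C := 1) (s := Set.univ)
    (x := b) (y := a) (fun x _ => differentiableAt_sigmoid) (fun x _ => ?_) convex_univ
    trivial trivial
  · simpa using this
  · rw [Real.deriv_sigmoid, Real.norm_eq_abs, abs_le]
    have h1 := Real.sigmoid_pos x
    have h2 := Real.sigmoid_lt_one x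
    constructor <;> nlinarith

lemma firstLayer_regular {B : ℝ} (s : ℕ) : Regular B (firstLayer p B s) := by
  constructor
  · rintro _ ⟨w, b, hw, -, rfl⟩ x
    rw [abs_of_pos (Real.sigmoid_pos _)]
    exact Real.sigmoid_le_one _
  · rintro _ ⟨w, b, hw, -, rfl⟩ x y
    refine (abs_sigmoid_sub_le _ _).trans ?_
    rw [add_sub_add_right_eq_sub, ← inner_sub_right]
    exact (abs_real_inner_le_norm _ _).trans (mul_le_mul_of_nonneg_right hw (norm_nonneg _))

lemma firstLayer_nonempty {B : ℝ} (hB : 0 ≤ B) (s : ℕ) : (firstLayer p B s).Nonempty :=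
  ⟨_, 0, 0, by simpa using hB, by simp, rfl⟩

lemma mem_l1Combinations_self {m : ℕ} (hm : 0 < m) {F : Set (Vec p → ℝ)} {f : Vec p → ℝ}
    (hf : f ∈ F) : f ∈ l1Combinations m F := by
  refine ⟨fun i => if i = ⟨0, hm⟩ then 1 else 0, fun _ => f, fun _ => hf, ?_, ?_⟩
  · simp [apply_ite abs]
  · simp

/-- A node is carried to the next layer by giving it weight one, which needs positive widths.
Rectification fixes it because the sigmoid is nonnegative. -/
lemma firstLayer_subset_layer {B : ℝ} {s : ℕ} {d : ℕ → ℕ} (hd : ∀ l, 0 < d l) (l : ℕ) :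
    firstLayer p B s ⊆ layer p B s d l := by
  induction l with
  | zero => exact subset_rfl
  | succ l ih =>
    intro f hf
    refine ⟨f, mem_l1Combinations_self (hd _) (ih hf), ?_⟩
    obtain ⟨w, b, -, -, rfl⟩ := hf
    ext x
    rw [max_eq_left (Real.sigmoid_nonneg _)]

lemma firstLayer_subset_sparseNet {B : ℝ} {L s : ℕ} {d : ℕ → ℕ} (hd : ∀ l, 0 < d l) :
    firstLayer p B s ⊆ sparseNet p B L s d := by
  match L with
  | 0 => exact subset_rfl
  | 1 => exact subset_rfl
  | l + 2 =>
    intro f hf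
    exact mem_l1Combinations_self (hd _) (firstLayer_subset_layer hd l hf)

lemma layer_regular {B : ℝ} (hB : 0 ≤ B) (s : ℕ) (d : ℕ → ℕ) (l : ℕ) :
    Regular B (layer p B s d l) := by
  induction l with
  | zero => exact firstLayer_regular s
  | succ l ih => exact (ih.l1Combinations hB _).relu

lemma sparseNet_regular {B : ℝ} (hB : 0 ≤ B) (L s : ℕ) (d : ℕ → ℕ) :
    Regular B (sparseNet p B L s d) := by
  match L with
  | 0 => exact firstLayer_regular s
  | 1 => exact firstLayer_regular s
  | l + 2 => exact (layer_regular hB s d l).l1Combinations hB _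

lemma rad_layer_le {n : ℕ} {B : ℝ} (hB : 0 ≤ B) (s : ℕ) {d : ℕ → ℕ} (hd : ∀ l, 0 < d l) (l : ℕ)
    (x : Fin n → Vec p) :
    rad (layer p B s d l) x ≤ 2 ^ l * rad (firstLayer p B s) x := by
  induction l with
  | zero => simp [layer]
  | succ l ih =>
    have hne : (l1Combinations (d (l + 1)) (layer p B s d l)).Nonempty := by
      obtain ⟨f, hf⟩ := firstLayer_nonempty (p := p) hB s
      exact ⟨f, mem_l1Combinations_self (hd _) (firstLayer_subset_layer hd l hf)⟩
    have hreg := layer_regular (p := p) hB s d l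
    calc rad (layer p B s d (l + 1)) x
        ≤ 2 * rad (l1Combinations (d (l + 1)) (layer p B s d l)) x :=
          rad_relu_le hne (hreg.l1Combinations hB _).bound x
      _ ≤ 2 * rad (layer p B s d l) x :=
          mul_le_mul_of_nonneg_left (rad_l1Combinations_le _ hreg.bound x) (by norm_num)
      _ ≤ 2 * (2 ^ l * rad (firstLayer p B s) x) := mul_le_mul_of_nonneg_left ih (by norm_num)
      _ = 2 ^ (l + 1) * rad (firstLayer p B s) x := by ring

/-- The Rademacher average of the network class is at most `2 ^ L` times that of its nodes in the
first layer. -/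
theorem rad_sparseNet_le {n : ℕ} {B : ℝ} (hB : 0 ≤ B) (L s : ℕ) {d : ℕ → ℕ} (hd : ∀ l, 0 < d l)
    (x : Fin n → Vec p) :
    rad (sparseNet p B L s d) x ≤ 2 ^ L * rad (firstLayer p B s) x := by
  have h0 := rad_nonneg (firstLayer p B s) x
  match L with
  | 0 => simp [sparseNet]
  | 1 => simp only [sparseNet]; linarith
  | l + 2 =>
    calc rad (sparseNet p B (l + 2) s d) x ≤ rad (layer p B s d l) x :=
          rad_l1Combinations_le _ (layer_regular hB s d l).bound x
      _ ≤ 2 ^ l * rad (firstLayer p B s) x := rad_layer_le hB s hd l x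
      -- A network with `l + 2` layers contains only `l` rectifications, so the factor `2 ^ L` has
      -- room to spare.
      _ ≤ 2 ^ (l + 2) * rad (firstLayer p B s) x := by
          refine mul_le_mul_of_nonneg_right ?_ h0
          exact pow_le_pow_right₀ (by norm_num) (by omega)

end Network

open scoped FourierTransform

/-! ### Quadratic lower bounds for the hyperbolic cosine. -/

section Cosh

/-- The difference equals `2 * sinh ((a + b) / 2) * sinh ((a - b) / 2)`, and `sinh u ≥ u` for `u ≥
0`. -/
lemma sq_sub_sq_le_cosh_sub_cosh {a b : ℝ} (hb : 0 ≤ b) (hab : b ≤ a) :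
    (a ^ 2 - b ^ 2) / 2 ≤ Real.cosh a - Real.cosh b := by
  have h1 : Real.cosh a - Real.cosh b = 2 * (Real.sinh ((a + b) / 2) * Real.sinh ((a - b) / 2)) := by
    have e1 : a = (a + b) / 2 + (a - b) / 2 := by ring
    have e2 : b = (a + b) / 2 - (a - b) / 2 := by ring
    conv_lhs => rw [e1, Real.cosh_add]
    conv_lhs => rw [show Real.cosh b = Real.cosh ((a + b) / 2 - (a - b) / 2) by rw [← e2],
      Real.cosh_sub]
    ring
  have h2 : (a + b) / 2 ≤ Real.sinh ((a + b) / 2) := Real.self_le_sinh_iff.2 (by linarith)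
  have h3 : (a - b) / 2 ≤ Real.sinh ((a - b) / 2) := Real.self_le_sinh_iff.2 (by linarith)
  have h4 := mul_le_mul h2 h3 (by linarith) (le_trans (by linarith) h2)
  rw [h1]
  linarith

lemma one_add_sq_div_two_le_cosh (u : ℝ) : 1 + u ^ 2 / 2 ≤ Real.cosh u := by
  have := sq_sub_sq_le_cosh_sub_cosh le_rfl (abs_nonneg u)
  simp at this
  linarith

end Cosh

/-! ### Fourier representation of the sigmoid. -/

section SigmoidDeriv

/-- The derivative of the sigmoid function. -/
def sigmoidDeriv (u : ℝ) : ℝ := Real.sigmoid u * (1 - Real.sigmoid u)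

lemma sigmoidDeriv_pos (u : ℝ) : 0 < sigmoidDeriv u :=
  mul_pos (Real.sigmoid_pos u) (by linarith [Real.sigmoid_lt_one u])

lemma sigmoidDeriv_le_one (u : ℝ) : sigmoidDeriv u ≤ 1 := by
  have := Real.sigmoid_pos u
  have := Real.sigmoid_lt_one u
  unfold sigmoidDeriv
  nlinarith

lemma sigmoidDeriv_le (u : ℝ) : sigmoidDeriv u ≤ (1 + u ^ 2)⁻¹ := by
  have h : sigmoidDeriv u = (2 + 2 * Real.cosh u)⁻¹ := by
    rw [sigmoidDeriv, ← Real.sigmoid_neg, Real.sigmoid_def, Real.sigmoid_def, ← mul_inv, neg_neg,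
      Real.cosh_eq]
    congr 1
    have : Real.exp (-u) * Real.exp u = 1 := by rw [← Real.exp_add]; simp
    linear_combination this
  rw [h]
  have := one_add_sq_div_two_le_cosh u
  exact inv_anti₀ (by positivity) (by nlinarith [sq_nonneg u])

lemma continuous_sigmoidDeriv : Continuous sigmoidDeriv :=
  continuous_sigmoid.mul (continuous_const.sub continuous_sigmoid)

lemma integrable_sigmoidDeriv : Integrable sigmoidDeriv :=
  integrable_inv_one_add_sq.mono' continuous_sigmoidDeriv.aestronglyMeasurable
    (Filter.Eventually.of_forall fun u => by
      rw [Real.norm_eq_abs, abs_of_pos (sigmoidDeriv_pos u)]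
      exact sigmoidDeriv_le u)

lemma hasDerivAt_sigmoidDeriv (u : ℝ) :
    HasDerivAt sigmoidDeriv (sigmoidDeriv u * (1 - 2 * Real.sigmoid u)) u := by
  have h := Real.hasDerivAt_sigmoid u
  convert! h.mul (h.const_sub 1) using 1
  simp only [sigmoidDeriv]
  ring

lemma hasDerivAt_sigmoidDeriv_deriv (u : ℝ) :
    HasDerivAt (fun u => sigmoidDeriv u * (1 - 2 * Real.sigmoid u))
      (sigmoidDeriv u * (1 - 6 * sigmoidDeriv u)) u := by
  convert! (hasDerivAt_sigmoidDeriv u).mul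
    (((Real.hasDerivAt_sigmoid u).const_mul 2).const_sub 1) using 1
  simp only [sigmoidDeriv]
  ring

lemma integrable_sigmoidDeriv_mul {h : ℝ → ℝ} (hc : Continuous h) {C : ℝ}
    (hb : ∀ u, |h u| ≤ C) : Integrable (fun u => sigmoidDeriv u * h u) :=
  integrable_sigmoidDeriv.mul_bdd hc.aestronglyMeasurable (Filter.Eventually.of_forall hb)

/-- The Fourier transform of the derivative of the sigmoid function. -/
def sigmoidHat : ℝ → ℂ := 𝓕 (fun u : ℝ => (sigmoidDeriv u : ℂ))

lemma continuous_sigmoidHat : Continuous sigmoidHat :=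
  VectorFourier.fourierIntegral_continuous Real.continuous_fourierChar
    (by exact continuous_inner) integrable_sigmoidDeriv.ofReal

/-- The first two derivatives of `sigmoidDeriv` are integrable, and the transform of the second is
the original one times `(2πiw) ^ 2`. Hence `(1 + w ^ 2) * ‖sigmoidHat w‖` is bounded by the sum of
two `L¹` norms. -/
lemma integrable_sigmoidHat : Integrable sigmoidHat := by
  set g : ℝ → ℂ := fun u => (sigmoidDeriv u : ℂ) with hg
  set g₁ : ℝ → ℂ := fun u => ((sigmoidDeriv u * (1 - 2 * Real.sigmoid u) : ℝ) : ℂ) with hg₁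
  set g₂ : ℝ → ℂ := fun u => ((sigmoidDeriv u * (1 - 6 * sigmoidDeriv u) : ℝ) : ℂ) with hg₂
  have d1 : ∀ u, HasDerivAt g (g₁ u) u := fun u => (hasDerivAt_sigmoidDeriv u).ofReal_comp
  have d2 : ∀ u, HasDerivAt g₁ (g₂ u) u := fun u => (hasDerivAt_sigmoidDeriv_deriv u).ofReal_comp
  have i0 : Integrable g := integrable_sigmoidDeriv.ofReal
  have i1 : Integrable g₁ := (integrable_sigmoidDeriv_mul (h := fun u => 1 - 2 * Real.sigmoid u) (C := 1)
    (continuous_const.sub (continuous_const.mul continuous_sigmoid)) fun u => by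
      have := Real.sigmoid_pos u
      have := Real.sigmoid_lt_one u
      rw [abs_le]; constructor <;> linarith).ofReal
  have i2 : Integrable g₂ := (integrable_sigmoidDeriv_mul (h := fun u => 1 - 6 * sigmoidDeriv u) (C := 5)
    (continuous_const.sub (continuous_const.mul continuous_sigmoidDeriv)) fun u => by
      have := sigmoidDeriv_pos u
      have := sigmoidDeriv_le_one u
      rw [abs_le]; constructor <;> linarith).ofReal
  have e1 : deriv g = g₁ := funext fun u => (d1 u).deriv
  have e2 : deriv g₁ = g₂ := funext fun u => (d2 u).deriv
  have f1 := Real.fourier_deriv i0 (fun u => (d1 u).differentiableAt) (by rwa [e1])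
  have f2 := Real.fourier_deriv i1 (fun u => (d2 u).differentiableAt) (by rwa [e2])
  rw [e1] at f1
  rw [e2, f1] at f2
  have b0 : ∀ w, ‖𝓕 g w‖ ≤ ∫ v, ‖g v‖ :=
    fun w => VectorFourier.norm_fourierIntegral_le_integral_norm _ _ _ _ _
  have b2 : ∀ w, ‖𝓕 g₂ w‖ ≤ ∫ v, ‖g₂ v‖ :=
    fun w => VectorFourier.norm_fourierIntegral_le_integral_norm _ _ _ _ _
  refine (integrable_inv_one_add_sq.const_mul ((∫ v, ‖g v‖) + ∫ v, ‖g₂ v‖)).mono'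
    continuous_sigmoidHat.aestronglyMeasurable (Filter.Eventually.of_forall fun w => ?_)
  rw [← div_eq_mul_inv, le_div_iff₀ (by positivity), mul_add, mul_one]
  refine add_le_add (b0 w) (le_trans ?_ (b2 w))
  rw [f2]
  simp only [norm_smul, norm_mul, Complex.norm_I, Complex.norm_real, Complex.norm_ofNat, mul_one]
  rw [Real.norm_eq_abs, Real.norm_eq_abs, abs_of_pos Real.pi_pos]
  have h1 : w ^ 2 ≤ (2 * Real.pi * |w|) * (2 * Real.pi * |w|) := by
    have h2 : |w| ≤ 2 * Real.pi * |w| :=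
      le_mul_of_one_le_left (abs_nonneg w) (by linarith [Real.pi_gt_three])
    rw [← sq_abs w, sq]
    exact mul_self_le_mul_self (abs_nonneg w) h2
  calc ‖sigmoidHat w‖ * w ^ 2
      ≤ ‖sigmoidHat w‖ * ((2 * Real.pi * |w|) * (2 * Real.pi * |w|)) :=
        mul_le_mul_of_nonneg_left h1 (norm_nonneg _)
    _ = _ := by rw [sigmoidHat]; ring

lemma sigmoidDeriv_eq_integral (u : ℝ) :
    (sigmoidDeriv u : ℂ) = ∫ t, (Real.fourierChar (t * u) : ℂ) * sigmoidHat t := by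
  have h := congrFun (Continuous.fourierInv_fourier_eq
    (Complex.continuous_ofReal.comp continuous_sigmoidDeriv) integrable_sigmoidDeriv.ofReal
    integrable_sigmoidHat) u
  simp only [Function.comp_apply] at h
  rw [← h, Real.fourierInv_eq]
  refine integral_congr_ae (Filter.Eventually.of_forall fun t => ?_)
  simp [Circle.smul_def, sigmoidHat, mul_comm, Function.comp_def]

/-- The primitive vanishing at the origin of the character of frequency `t`. -/
def charPrim (t v : ℝ) : ℂ := ∫ u in (0 : ℝ)..v, (Real.fourierChar (t * u) : ℂ)

lemma continuous_fourierChar_coe : Continuous fun u : ℝ => (Real.fourierChar u : ℂ) :=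
  continuous_subtype_val.comp Real.continuous_fourierChar

lemma continuous_charPrim (v : ℝ) : Continuous fun t => charPrim t v := by
  refine intervalIntegral.continuous_parametric_intervalIntegral_of_continuous' ?_ 0 v
  exact continuous_fourierChar_coe.comp (continuous_fst.mul continuous_snd)

/-- The integrand has modulus one. The Lipschitz constant is uniform in the frequency, so the real
and imaginary parts are contractions vanishing at zero, to which `radAvg_contraction` applies
frequency by frequency. -/
lemma norm_charPrim_sub_le (t v v' : ℝ) : ‖charPrim t v - charPrim t v'‖ ≤ |v - v'| := by
  have hi : ∀ a b : ℝ, IntervalIntegrable (fun u => (Real.fourierChar (t * u) : ℂ)) volume a b :=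
    fun a b => (continuous_fourierChar_coe.comp (continuous_const.mul continuous_id)).intervalIntegrable
      _ _
  rw [charPrim, charPrim, intervalIntegral.integral_interval_sub_left (hi _ _) (hi _ _)]
  have := intervalIntegral.norm_integral_le_of_norm_le_const (a := v') (b := v) (C := 1)
    (f := fun u => (Real.fourierChar (t * u) : ℂ)) fun u _ => (Circle.norm_coe _).le
  simpa using this

lemma charPrim_zero (t : ℝ) : charPrim t 0 = 0 := by simp [charPrim]

lemma norm_charPrim_le (t v : ℝ) : ‖charPrim t v‖ ≤ |v| := by
  simpa [charPrim_zero] using norm_charPrim_sub_le t v 0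

/-- Spectral representation of the increments of the sigmoid function: the shift `b` only enters
through a phase. -/
lemma sigmoid_add_sub (b v : ℝ) :
    ((Real.sigmoid (v + b) - Real.sigmoid b : ℝ) : ℂ) =
      ∫ t, (Real.fourierChar (t * b) : ℂ) * sigmoidHat t * charPrim t v := by
  have h1 : Real.sigmoid (v + b) - Real.sigmoid b = ∫ u in (0 : ℝ)..v, sigmoidDeriv (u + b) := by
    rw [intervalIntegral.integral_comp_add_right, zero_add,
      intervalIntegral.integral_eq_sub_of_hasDerivAt (f := Real.sigmoid) (f' := sigmoidDeriv)
        (fun u _ => Real.hasDerivAt_sigmoid u) (continuous_sigmoidDeriv.intervalIntegrable _ _)]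
  rw [h1, ← intervalIntegral.integral_ofReal]
  simp only [charPrim, sigmoidDeriv_eq_integral, intervalIntegral.intervalIntegral_eq_integral_uIoc,
    mul_smul_comm, integral_smul]
  congr 1
  rw [integral_integral_swap]
  · refine integral_congr_ae (Filter.Eventually.of_forall fun t => ?_)
    simp only
    rw [← integral_const_mul]
    refine integral_congr_ae (Filter.Eventually.of_forall fun u => ?_)
    simp only [mul_add, AddChar.map_add_eq_mul, Circle.coe_mul]
    ring
  · have hb : Integrable (fun z : ℝ × ℝ => (1 : ℂ) * sigmoidHat z.2)
        ((volume.restrict (Set.uIoc 0 v)).prod volume) := by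
      have : IsFiniteMeasure (volume.restrict (Set.uIoc 0 v)) := by
        rw [Set.uIoc]; infer_instance
      exact (integrable_const (1 : ℂ)).mul_prod integrable_sigmoidHat
    refine hb.mono ?_ (Filter.Eventually.of_forall fun z => ?_)
    · refine Continuous.aestronglyMeasurable ?_
      refine (continuous_fourierChar_coe.comp ?_).mul (continuous_sigmoidHat.comp continuous_snd)
      fun_prop
    · rw [Function.uncurry, norm_mul, norm_mul, Circle.norm_coe, norm_one]

end SigmoidDeriv

/-! ### Removing the sigmoid and its bias from the Rademacher average. -/

section SigmoidRademacher

lemma sum_signSum_sq (n : ℕ) :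
    ∑ ξ : Fin n → Bool, (∑ i, sgn (ξ i)) ^ 2 = 2 ^ n * n := by
  induction n with
  | zero => simp
  | succ n ih =>
    rw [sum_bool_fun_succ]
    simp only [Fin.sum_univ_succ, Fin.cons_zero, Fin.cons_succ, sgn_true, sgn_false]
    have : ∀ S : ℝ, (1 + S) ^ 2 + (-1 + S) ^ 2 = 2 + 2 * S ^ 2 := fun S => by ring
    simp only [this, Finset.sum_add_distrib, ← Finset.mul_sum, ih]
    simp
    ring

lemma avg_abs_signSum_le (n : ℕ) :
    (2 ^ n : ℝ)⁻¹ * ∑ ξ : Fin n → Bool, |∑ i, sgn (ξ i)| ≤ Real.sqrt n := by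
  refine Real.le_sqrt_of_sq_le ?_
  have h := sq_sum_le_card_mul_sum_sq (s := (Finset.univ : Finset (Fin n → Bool)))
    (f := fun ξ => |∑ i, sgn (ξ i)|)
  simp only [sq_abs, sum_signSum_sq] at h
  simp only [Finset.card_univ, Fintype.card_fun, Fintype.card_bool, Fintype.card_fin] at h
  push_cast at h
  rw [mul_pow, inv_pow, inv_mul_le_iff₀ (by positivity)]
  calc _ ≤ _ := h
    _ = _ := by ring

variable {ι : Type*}

/-- Source of measurability for the uncountable suprema below: lower semicontinuous functions are
Borel, whatever the index set. -/
lemma lowerSemicontinuous_ciSup_of_continuous {X : Type*} [TopologicalSpace X] {f : ι → X → ℝ}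
    (hb : ∀ x, Bdd fun t => f t x) (hf : ∀ t, Continuous (f t)) :
    LowerSemicontinuous fun x => ⨆ t, f t x :=
  lowerSemicontinuous_ciSup (fun x => (hb x).bddAbove) fun t => (hf t).lowerSemicontinuous

/-- A Lipschitz functional of bounded contractions: integrability against `sigmoidHat`. -/
lemma integrable_norm_sigmoidHat_mul_iSup {n : ℕ} {h : Fin n → ι → ℝ → ℝ} {C : Fin n → ℝ}
    (hC : ∀ i t s, |h i t s| ≤ C i) (hc : ∀ i t, Continuous (h i t)) (ξ : Fin n → Bool) :
    Integrable fun s => ‖sigmoidHat s‖ * ⨆ t, |∑ i, sgn (ξ i) * h i t s| := by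
  have hb : ∀ t s, |∑ i, sgn (ξ i) * h i t s| ≤ ∑ i, C i := fun t s =>
    (Finset.abs_sum_le_sum_abs _ _).trans (Finset.sum_le_sum fun i _ => by
      rw [abs_mul, abs_sgn, one_mul]; exact hC i t s)
  have hm : Measurable fun s => ⨆ t, |∑ i, sgn (ξ i) * h i t s| := by
    refine (lowerSemicontinuous_ciSup_of_continuous (fun s => ⟨∑ i, C i, fun t => ?_⟩)
      fun t => ?_).measurable
    · rw [abs_abs]; exact hb t s
    · exact continuous_abs.comp (continuous_finsetSum _ fun i _ => continuous_const.mul (hc i t))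
  refine integrable_sigmoidHat.norm.mul_bdd (c := |∑ i, C i|) hm.aestronglyMeasurable
    (Filter.Eventually.of_forall fun s => ?_)
  rw [Real.norm_eq_abs, abs_of_nonneg (Real.iSup_nonneg fun _ => abs_nonneg _)]
  exact Real.iSup_le (fun t => (hb t s).trans (le_abs_self _)) (abs_nonneg _)

/-- The Rademacher average of sigmoid nodes with arbitrary bias is controlled by the one of their
linear parts. -/
theorem radAvg_sigmoid_le [Nonempty ι] {n : ℕ} {u : Fin n → ι → ℝ} (hu : ∀ i, Bdd (u i)) :
    radAvg (fun i (t : ι × ℝ) => Real.sigmoid (u i t.1 + t.2)) ≤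
      Real.sqrt n + 4 * (∫ s, ‖sigmoidHat s‖) * radAvg u := by
  choose C hC using hu
  let hr : Fin n → ι → ℝ → ℝ := fun i t s => (charPrim s (u i t)).re
  let hi : Fin n → ι → ℝ → ℝ := fun i t s => (charPrim s (u i t)).im
  have hrC : ∀ i t s, |hr i t s| ≤ C i := fun i t s =>
    ((Complex.abs_re_le_norm _).trans (norm_charPrim_le _ _)).trans (hC i t)
  have hiC : ∀ i t s, |hi i t s| ≤ C i := fun i t s =>
    ((Complex.abs_im_le_norm _).trans (norm_charPrim_le _ _)).trans (hC i t)
  have hrc : ∀ i t, Continuous (hr i t) := fun i t =>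
    Complex.continuous_re.comp (continuous_charPrim _)
  have hic : ∀ i t, Continuous (hi i t) := fun i t =>
    Complex.continuous_im.comp (continuous_charPrim _)
  let R : (Fin n → Bool) → ℝ → ℝ := fun ξ s => ⨆ t, |∑ i, sgn (ξ i) * hr i t s|
  let I : (Fin n → Bool) → ℝ → ℝ := fun ξ s => ⨆ t, |∑ i, sgn (ξ i) * hi i t s|
  have intR : ∀ ξ, Integrable fun s => ‖sigmoidHat s‖ * R ξ s :=
    fun ξ => integrable_norm_sigmoidHat_mul_iSup hrC hrc ξ
  have intI : ∀ ξ, Integrable fun s => ‖sigmoidHat s‖ * I ξ s :=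
    fun ξ => integrable_norm_sigmoidHat_mul_iSup hiC hic ξ
  have hpt : ∀ ξ : Fin n → Bool, ⨆ t : ι × ℝ, |∑ i, sgn (ξ i) * Real.sigmoid (u i t.1 + t.2)| ≤
      |∑ i, sgn (ξ i)| + ((∫ s, ‖sigmoidHat s‖ * R ξ s) + ∫ s, ‖sigmoidHat s‖ * I ξ s) := by
    intro ξ
    refine ciSup_le ?_
    rintro ⟨t, b⟩
    -- The value `σ(b)` lies in `[0, 1]` and does not depend on `i`, so it contributes at most `|∑
    -- ξᵢ|`, of mean at most `√n`. The increments are left to the spectral representation.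
    have e1 : ∑ i, sgn (ξ i) * Real.sigmoid (u i t + b) = Real.sigmoid b * ∑ i, sgn (ξ i) +
        ∑ i, sgn (ξ i) * (Real.sigmoid (u i t + b) - Real.sigmoid b) := by
      rw [Finset.mul_sum, ← Finset.sum_add_distrib]
      exact Finset.sum_congr rfl fun _ _ => by ring
    have e2 : ((∑ i, sgn (ξ i) * (Real.sigmoid (u i t + b) - Real.sigmoid b) : ℝ) : ℂ) =
        ∫ s, (Real.fourierChar (s * b) : ℂ) * sigmoidHat s *
          ∑ i, (sgn (ξ i) : ℂ) * charPrim s (u i t) := by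
      have hint : ∀ i, Integrable fun s : ℝ => (sgn (ξ i) : ℂ) *
          ((Real.fourierChar (s * b) : ℂ) * sigmoidHat s * charPrim s (u i t)) := by
        intro i
        refine Integrable.const_mul ?_ _
        refine (integrable_sigmoidHat.norm.mul_const (C i)).mono' ?_
          (Filter.Eventually.of_forall fun s => ?_)
        · exact (((continuous_fourierChar_coe.comp (continuous_id.mul continuous_const)).mul
            continuous_sigmoidHat).mul (continuous_charPrim _)).aestronglyMeasurable
        · rw [norm_mul, norm_mul, Circle.norm_coe, one_mul]
          exact mul_le_mul_of_nonneg_left ((norm_charPrim_le _ _).trans (hC i t)) (norm_nonneg _)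
      push_cast
      simp only [← Complex.ofReal_sub, sigmoid_add_sub, ← integral_const_mul]
      rw [← integral_finsetSum _ fun i _ => hint i]
      refine integral_congr_ae (Filter.Eventually.of_forall fun s => ?_)
      simp only [Finset.mul_sum]
      exact Finset.sum_congr rfl fun _ _ => by ring
    -- The bias enters only through a factor of modulus one, so taking norms under the integral
    -- gives a bound uniform in `b`.
    have e3 : |∑ i, sgn (ξ i) * (Real.sigmoid (u i t + b) - Real.sigmoid b)| ≤
        (∫ s, ‖sigmoidHat s‖ * R ξ s) + ∫ s, ‖sigmoidHat s‖ * I ξ s := by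
      rw [← integral_add (intR ξ) (intI ξ), ← Real.norm_eq_abs, ← Complex.norm_real, e2]
      refine norm_integral_le_of_norm_le ((intR ξ).add (intI ξ))
        (Filter.Eventually.of_forall fun s => ?_)
      rw [norm_mul, norm_mul, Circle.norm_coe, one_mul, ← mul_add]
      refine mul_le_mul_of_nonneg_left ?_ (norm_nonneg _)
      refine (Complex.norm_le_abs_re_add_abs_im _).trans (add_le_add ?_ ?_)
      · have : (∑ i, (sgn (ξ i) : ℂ) * charPrim s (u i t)).re = ∑ i, sgn (ξ i) * hr i t s := by
          simp [hr]
        rw [this]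
        exact (signSum_bdd (u := fun i t => hr i t s) (fun i => ⟨C i, fun t => hrC i t s⟩)
          ξ).abs.le_ciSup t
      · have : (∑ i, (sgn (ξ i) : ℂ) * charPrim s (u i t)).im = ∑ i, sgn (ξ i) * hi i t s := by
          simp [hi]
        rw [this]
        exact (signSum_bdd (u := fun i t => hi i t s) (fun i => ⟨C i, fun t => hiC i t s⟩)
          ξ).abs.le_ciSup t
    simp only
    rw [e1]
    refine (abs_add_le _ _).trans (add_le_add ?_ e3)
    rw [abs_mul, abs_of_pos (Real.sigmoid_pos _)]
    exact mul_le_of_le_one_left (abs_nonneg _) (Real.sigmoid_le_one _)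
  have hR : ∀ s, (2 ^ n : ℝ)⁻¹ * ∑ ξ, R ξ s ≤ 2 * radAvg u := fun s =>
    radAvg_contraction (v := fun i t => hr i t s) (fun i => ⟨C i, hC i⟩)
      (fun i t => (Complex.abs_re_le_norm _).trans (norm_charPrim_le _ _)) fun i t t' => by
        have := (Complex.abs_re_le_norm _).trans (norm_charPrim_sub_le s (u i t) (u i t'))
        rwa [Complex.sub_re] at this
  have hI : ∀ s, (2 ^ n : ℝ)⁻¹ * ∑ ξ, I ξ s ≤ 2 * radAvg u := fun s =>
    radAvg_contraction (v := fun i t => hi i t s) (fun i => ⟨C i, hC i⟩)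
      (fun i t => (Complex.abs_im_le_norm _).trans (norm_charPrim_le _ _)) fun i t t' => by
        have := (Complex.abs_im_le_norm _).trans (norm_charPrim_sub_le s (u i t) (u i t'))
        rwa [Complex.sub_im] at this
  -- Applied to the real and the imaginary part; each costs a contraction factor 2, which gives the
  -- constant 4.
  have avg : ∀ J : (Fin n → Bool) → ℝ → ℝ, (∀ ξ, Integrable fun s => ‖sigmoidHat s‖ * J ξ s) →
      (∀ s, (2 ^ n : ℝ)⁻¹ * ∑ ξ, J ξ s ≤ 2 * radAvg u) →
      (2 ^ n : ℝ)⁻¹ * ∑ ξ, ∫ s, ‖sigmoidHat s‖ * J ξ s ≤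
        2 * (∫ s, ‖sigmoidHat s‖) * radAvg u := by
    intro J hJ hle
    rw [← integral_finsetSum _ fun ξ _ => hJ ξ, ← integral_const_mul,
      show 2 * (∫ s, ‖sigmoidHat s‖) * radAvg u = ∫ s, ‖sigmoidHat s‖ * (2 * radAvg u) by
        rw [integral_mul_const]; ring]
    refine integral_mono ((integrable_finsetSum _ fun ξ _ => hJ ξ).const_mul _)
      (integrable_sigmoidHat.norm.mul_const _) fun s => ?_
    simp only
    rw [← Finset.mul_sum, mul_left_comm]
    exact mul_le_mul_of_nonneg_left (hle s) (norm_nonneg _)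
  calc radAvg (fun i (t : ι × ℝ) => Real.sigmoid (u i t.1 + t.2))
      ≤ (2 ^ n : ℝ)⁻¹ * ∑ ξ : Fin n → Bool, (|∑ i, sgn (ξ i)| +
          ((∫ s, ‖sigmoidHat s‖ * R ξ s) + ∫ s, ‖sigmoidHat s‖ * I ξ s)) :=
        mul_le_mul_of_nonneg_left (Finset.sum_le_sum fun ξ _ => hpt ξ) (by positivity)
    _ ≤ _ := by
        rw [Finset.sum_add_distrib, Finset.sum_add_distrib, mul_add, mul_add]
        linarith [avg_abs_signSum_le n, avg R intR hR, avg I intI hI]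

end SigmoidRademacher

/-! ### Reduction of the first layer to sparse linear functions. -/

section FirstLayer

variable {p : ℕ}

/-- The `s`-sparse vectors of Euclidean norm at most `B`. -/
def sparseBall (p : ℕ) (B : ℝ) (s : ℕ) : Set (Vec p) :=
  {w | ‖w‖ ≤ B ∧ {i | w i ≠ 0}.ncard ≤ s}

/-- Rademacher average of the first layer in terms of sparse linear functions. -/
theorem rad_firstLayer_le {n : ℕ} {B : ℝ} (hB : 0 ≤ B) (s : ℕ) (x : Fin n → Vec p) :
    rad (firstLayer p B s) x ≤ Real.sqrt n + 4 * (∫ t, ‖sigmoidHat t‖) *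
      radAvg (fun i (w : sparseBall p B s) => inner ℝ w.1 (x i)) := by
  have : Nonempty (sparseBall p B s) := ⟨⟨0, by simpa using hB, by simp⟩⟩
  refine le_trans (radAvg_mono fun ξ => ?_) (radAvg_sigmoid_le fun i => ⟨B * ‖x i‖, fun w => ?_⟩)
  · refine Real.iSup_le ?_ (Real.iSup_nonneg fun _ => abs_nonneg _)
    rintro ⟨f, w, b, hw, hs, rfl⟩
    have hb : Bdd fun t : sparseBall p B s × ℝ =>
        ∑ i, sgn (ξ i) * Real.sigmoid (inner ℝ t.1.1 (x i) + t.2) :=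
      signSum_bdd (u := fun i (t : sparseBall p B s × ℝ) =>
        Real.sigmoid (inner ℝ t.1.1 (x i) + t.2)) (fun i => ⟨1, fun t => by
          rw [abs_of_pos (Real.sigmoid_pos _)]; exact Real.sigmoid_le_one _⟩) ξ
    exact hb.abs.le_ciSup (⟨w, hw, hs⟩, b)
  · exact (abs_real_inner_le_norm _ _).trans (mul_le_mul_of_nonneg_right w.2.1 (norm_nonneg _))

end FirstLayer

open scoped NNReal

/-! ### McDiarmid's inequality in sub-Gaussian form. -/

section BoundedDifferences

variable {E : Type*} [MeasurableSpace E]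

lemma integrable_of_bdd {α : Type*} [MeasurableSpace α] {μ : Measure α} [IsFiniteMeasure μ]
    {f : α → ℝ} (hm : Measurable f) (hb : Bdd f) : Integrable f μ := by
  obtain ⟨C, hC⟩ := hb
  exact Integrable.of_bound hm.aestronglyMeasurable C (Filter.Eventually.of_forall hC)

lemma bdd_exp {α : Type*} {f : α → ℝ} (hf : Bdd f) : Bdd fun a => Real.exp (f a) := by
  obtain ⟨C, hC⟩ := hf
  exact ⟨Real.exp C, fun a => by
    rw [abs_of_pos (Real.exp_pos _)]
    exact Real.exp_le_exp.2 ((le_abs_self _).trans (hC a))⟩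

/-- After centering the values lie in `[-c, c]`, and Hoeffding's lemma turns this interval of length
`2c` into variance proxy `c ^ 2`. The sharp `c ^ 2 / 4` would only improve constants. -/
lemma hasSubgaussianMGF_of_osc {μ : Measure E} [IsProbabilityMeasure μ] {g : E → ℝ}
    (hm : Measurable g) (hb : Bdd g) {c : ℝ≥0} (h : ∀ a b, |g a - g b| ≤ c) :
    HasSubgaussianMGF (fun a => g a - ∫ b, g b ∂μ) (c ^ 2) μ := by
  have hg := integrable_of_bdd (μ := μ) hm hb
  have hI : ∀ a, |g a - ∫ b, g b ∂μ| ≤ c := by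
    intro a
    have : g a - ∫ b, g b ∂μ = ∫ b, (g a - g b) ∂μ := by
      rw [integral_sub (integrable_const _) hg]; simp
    rw [this, ← Real.norm_eq_abs]
    refine (norm_integral_le_of_norm_le_const (C := c)
      (Filter.Eventually.of_forall fun b => h a b)).trans (by simp)
  have := hasSubgaussianMGF_of_mem_Icc_of_integral_eq_zero (μ := μ)
    (X := fun a => g a - ∫ b, g b ∂μ) (a := -c) (b := c) (hm.sub_const _).aemeasurable
    (Filter.Eventually.of_forall fun a => abs_le.1 (hI a))
    (by rw [integral_sub hg (integrable_const _)]; simp)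
  convert this using 2
  ext
  simp only [NNReal.coe_div, coe_nnnorm, NNReal.coe_ofNat]
  rw [Real.norm_eq_abs, abs_of_nonneg (by linarith [c.2])]
  ring

/-- Sub-Gaussian form of McDiarmid's bounded difference inequality. -/
theorem hasSubgaussianMGF_of_bounded_differences {μ : Measure E} [IsProbabilityMeasure μ] {n : ℕ}
    {f : (Fin n → E) → ℝ} (hm : Measurable f) (hb : Bdd f) {c : ℝ≥0}
    (h : ∀ i x y, (∀ j, j ≠ i → x j = y j) → |f x - f y| ≤ c) :
    HasSubgaussianMGF (fun x => f x - ∫ y, f y ∂(Measure.pi fun _ => μ)) (n * c ^ 2)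
      (Measure.pi fun _ => μ) := by
  induction n with
  | zero =>
    have : (fun x => f x - ∫ y, f y ∂(Measure.pi fun _ : Fin 0 => μ)) = fun _ => 0 := by
      ext x
      have : f = fun _ => f x := funext fun y => congrArg f (Subsingleton.elim _ _)
      rw [this]
      simp
    rw [this]
    simp
  | succ n ih =>
    set ν : Measure (Fin n → E) := Measure.pi fun _ => μ with hν
    have mp := (measurePreserving_piFinSuccAbove (fun _ : Fin (n + 1) => μ) 0).symm
    set e := (MeasurableEquiv.piFinSuccAbove (fun _ : Fin (n + 1) => E) 0).symm with he
    let F : E × (Fin n → E) → ℝ := fun z => f (e z)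
    have hF : Measurable F := hm.comp e.measurable
    have hFb : Bdd F := by
      obtain ⟨C, hC⟩ := hb
      exact ⟨C, fun z => hC _⟩
    -- The first coordinate is split off and the others are integrated out. `F (a, ·) - g a` is
    -- handled by the induction hypothesis for each fixed `a`, and `g` inherits the oscillation
    -- bound, so the variance proxies add.
    let g : E → ℝ := fun a => ∫ y, F (a, y) ∂ν
    have hgm : Measurable g := (hF.stronglyMeasurable.integral_prod_right' (ν := ν)).measurable
    have hFa : ∀ a, Bdd fun y => F (a, y) := fun a => by
      obtain ⟨C, hC⟩ := hFb
      exact ⟨C, fun y => hC _⟩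
    have hFam : ∀ a, Measurable fun y => F (a, y) := fun a => hF.comp measurable_prodMk_left
    have hgb : Bdd g := by
      obtain ⟨C, hC⟩ := hFb
      refine ⟨C, fun a => ?_⟩
      rw [← Real.norm_eq_abs]
      exact (norm_integral_le_of_norm_le_const (C := C)
        (Filter.Eventually.of_forall fun y => hC (a, y))).trans (by simp)
    have e_zero : ∀ a y, e (a, y) 0 = a := fun a y => by
      simp [he, MeasurableEquiv.piFinSuccAbove, Fin.insertNthEquiv]
    have e_succ : ∀ a y j, e (a, y) (Fin.succ j) = y j := fun a y j => by
      simp [he, MeasurableEquiv.piFinSuccAbove, Fin.insertNthEquiv]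
    have hgosc : ∀ a b, |g a - g b| ≤ c := by
      intro a b
      have : g a - g b = ∫ y, (F (a, y) - F (b, y)) ∂ν :=
        (integral_sub (integrable_of_bdd (hFam a) (hFa a))
          (integrable_of_bdd (hFam b) (hFa b))).symm
      rw [this, ← Real.norm_eq_abs]
      refine (norm_integral_le_of_norm_le_const (C := c)
        (Filter.Eventually.of_forall fun y => ?_)).trans (by simp)
      refine h 0 _ _ fun j hj => ?_
      obtain ⟨j, rfl⟩ := Fin.exists_succ_eq.2 hj
      rw [e_succ, e_succ]
    have hint : ∫ x, f x ∂(Measure.pi fun _ : Fin (n + 1) => μ) = ∫ a, g a ∂μ := by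
      rw [← mp.integral_comp e.measurableEmbedding]
      exact integral_prod (μ := μ) (ν := ν) F (integrable_of_bdd hF hFb)
    have h1 : ∀ a, HasSubgaussianMGF (fun y => F (a, y) - g a) (n * c ^ 2) ν := by
      intro a
      refine ih (hFam a) (hFa a) fun i x y hxy => ?_
      refine h i.succ _ _ fun j hj => ?_
      cases j using Fin.cases with
      | zero => rw [e_zero, e_zero]
      | succ j => rw [e_succ, e_succ]; exact hxy j fun h => hj (by rw [h])
    have h2 := hasSubgaussianMGF_of_osc (μ := μ) hgm hgb hgosc
    rw [hint]
    set m := ∫ a, g a ∂μ with hm'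
    have hcb : ∀ m : ℝ, Bdd fun x => f x - m := fun m => by
      simpa only [sub_eq_add_neg] using hb.add (v := fun _ => -m) ⟨|-m|, fun _ => le_rfl⟩
    refine ⟨fun t => integrable_of_bdd (by fun_prop) (bdd_exp ((hcb m).const_mul t)), fun t => ?_⟩
    have hexp : ∫ x, Real.exp (t * (f x - m)) ∂(Measure.pi fun _ : Fin (n + 1) => μ) =
        ∫ a, Real.exp (t * (g a - m)) * ∫ y, Real.exp (t * (F (a, y) - g a)) ∂ν ∂μ := by
      rw [← mp.integral_comp e.measurableEmbedding]
      have hFm : Bdd fun z => F z - m := by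
        obtain ⟨C, hC⟩ := hcb m
        exact ⟨C, fun z => hC _⟩
      refine (integral_prod (μ := μ) (ν := ν) (fun z => Real.exp (t * (F z - m)))
        (integrable_of_bdd (by fun_prop) (bdd_exp (hFm.const_mul t)))).trans ?_
      refine integral_congr_ae (Filter.Eventually.of_forall fun a => ?_)
      simp only
      rw [← integral_const_mul]
      refine integral_congr_ae (Filter.Eventually.of_forall fun y => ?_)
      simp only
      rw [← Real.exp_add]
      congr 1
      ring
    rw [mgf, hexp]
    calc ∫ a, Real.exp (t * (g a - m)) * ∫ y, Real.exp (t * (F (a, y) - g a)) ∂ν ∂μ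
        ≤ ∫ a, Real.exp (t * (g a - m)) * Real.exp ((n * c ^ 2 : ℝ≥0) * t ^ 2 / 2) ∂μ := by
          refine integral_mono_of_nonneg (Filter.Eventually.of_forall fun a => ?_)
            ((h2.integrable_exp_mul t).mul_const _) (Filter.Eventually.of_forall fun a => ?_)
          · exact mul_nonneg (Real.exp_pos _).le (integral_nonneg fun _ => (Real.exp_pos _).le)
          · exact mul_le_mul_of_nonneg_left ((h1 a).mgf_le t) (Real.exp_pos _).le
      _ ≤ Real.exp ((c ^ 2 : ℝ≥0) * t ^ 2 / 2) * Real.exp ((n * c ^ 2 : ℝ≥0) * t ^ 2 / 2) := by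
          rw [integral_mul_const]
          exact mul_le_mul_of_nonneg_right (h2.mgf_le t) (Real.exp_pos _).le
      _ = Real.exp (((n + 1 : ℕ) * c ^ 2 : ℝ≥0) * t ^ 2 / 2) := by
          rw [← Real.exp_add]
          congr 1
          push_cast
          ring

end BoundedDifferences

/-! ### Uniform deviation: concentration, symmetrization, contamination. -/

section Deviation

variable {p n : ℕ}

/-- The deviation `sup_f |P_n f - E_ν f|` of the empirical means of the sample `x` over a class. -/
def dev (F : Set (Vec p → ℝ)) (ν : Measure (Vec p)) (x : Fin n → Vec p) : ℝ :=
  ⨆ f : F, |(n : ℝ)⁻¹ * ∑ i, f.1 (x i) - ∫ y, f.1 y ∂ν|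

variable {B : ℝ} {F : Set (Vec p → ℝ)} {ν : Measure (Vec p)}

lemma Regular.integrable (hF : Regular B F) [IsFiniteMeasure ν] {f : Vec p → ℝ} (hf : f ∈ F) :
    Integrable f ν :=
  integrable_of_bdd (hF.continuous hf).measurable ⟨1, hF.bound f hf⟩

lemma Regular.abs_integral_le (hF : Regular B F) [IsProbabilityMeasure ν] {f : Vec p → ℝ}
    (hf : f ∈ F) : |∫ y, f y ∂ν| ≤ 1 := by
  rw [← Real.norm_eq_abs]
  exact (norm_integral_le_of_norm_le_const (C := 1)
    (Filter.Eventually.of_forall fun y => hF.bound f hf y)).trans (by simp)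

lemma abs_avg_le {a : Fin n → ℝ} {C : ℝ} (hC : 0 ≤ C) (ha : ∀ i, |a i| ≤ C) :
    |(n : ℝ)⁻¹ * ∑ i, a i| ≤ C := by
  rw [Finset.mul_sum]
  refine abs_sum_mul_le hC ?_ ha
  rw [Finset.sum_const, Finset.card_univ, Fintype.card_fin, nsmul_eq_mul, abs_of_nonneg (by positivity)]
  exact mul_inv_le_one

lemma Regular.abs_dev_term_le (hF : Regular B F) [IsProbabilityMeasure ν] (x : Fin n → Vec p)
    (f : F) : |(n : ℝ)⁻¹ * ∑ i, f.1 (x i) - ∫ y, f.1 y ∂ν| ≤ 2 := by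
  refine (abs_sub _ _).trans ?_
  have h1 := abs_avg_le (n := n) zero_le_one fun i => hF.bound f.1 f.2 (x i)
  have h2 := hF.abs_integral_le (ν := ν) f.2
  linarith

lemma Regular.bdd_dev_term (hF : Regular B F) [IsProbabilityMeasure ν] (x : Fin n → Vec p) :
    Bdd fun f : F => |(n : ℝ)⁻¹ * ∑ i, f.1 (x i) - ∫ y, f.1 y ∂ν| :=
  Bdd.abs ⟨2, hF.abs_dev_term_le x⟩

lemma dev_nonneg (F : Set (Vec p → ℝ)) (ν : Measure (Vec p)) (x : Fin n → Vec p) :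
    0 ≤ dev F ν x := Real.iSup_nonneg fun _ => abs_nonneg _

lemma Regular.bdd_dev (hF : Regular B F) [IsProbabilityMeasure ν] :
    Bdd (dev F ν : (Fin n → Vec p) → ℝ) :=
  ⟨2, fun x => by
    rw [abs_of_nonneg (dev_nonneg _ _ _)]
    exact Real.iSup_le (hF.abs_dev_term_le x) zero_le_two⟩

lemma Regular.measurable_dev (hF : Regular B F) [IsProbabilityMeasure ν] :
    Measurable (dev F ν : (Fin n → Vec p) → ℝ) :=
  (lowerSemicontinuous_ciSup_of_continuous (fun x => hF.bdd_dev_term x) fun f =>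
    continuous_abs.comp ((continuous_const.mul (continuous_finsetSum _ fun i _ =>
      (hF.continuous f.2).comp (continuous_apply i))).sub continuous_const)).measurable

lemma Regular.dev_le_add (hF : Regular B F) [IsProbabilityMeasure ν] {x y : Fin n → Vec p} {C : ℝ}
    (hC : 0 ≤ C) (h : ∀ f ∈ F, |(n : ℝ)⁻¹ * ∑ i, (f (x i) - f (y i))| ≤ C) :
    dev F ν x ≤ dev F ν y + C := by
  refine Real.iSup_le (fun f => ?_) (add_nonneg (dev_nonneg _ _ _) hC)
  have h1 := (hF.bdd_dev_term (ν := ν) y).le_ciSup f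
  have h2 := h f.1 f.2
  have : (n : ℝ)⁻¹ * ∑ i, f.1 (x i) - ∫ y, f.1 y ∂ν =
      ((n : ℝ)⁻¹ * ∑ i, f.1 (y i) - ∫ y, f.1 y ∂ν) +
        (n : ℝ)⁻¹ * ∑ i, (f.1 (x i) - f.1 (y i)) := by
    rw [Finset.sum_sub_distrib]; ring
  rw [this]
  exact (abs_add_le _ _).trans (add_le_add h1 h2)

open scoped NNReal in
/-- Concentration of the deviation around its mean. -/
theorem Regular.dev_concentration (hF : Regular B F) [IsProbabilityMeasure ν] (hn : 0 < n)
    (P : Measure (Vec p)) [IsProbabilityMeasure P] {t : ℝ} (ht : 0 ≤ t) :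
    (Measure.pi fun _ : Fin n => P).real
      {x | (∫ y, dev F ν y ∂(Measure.pi fun _ : Fin n => P)) + t ≤ dev F ν x} ≤
      Real.exp (-(n * t ^ 2 / 8)) := by
  have hn' : (0 : ℝ) < n := by exact_mod_cast hn
  have hdiff : ∀ (i : Fin n) (x y : Fin n → Vec p), (∀ j, j ≠ i → x j = y j) →
      dev F ν x ≤ dev F ν y + 2 / n := by
    intro i x y hxy
    refine hF.dev_le_add (by positivity) fun f hf => ?_
    rw [Finset.sum_eq_single i (fun j _ hj => by rw [hxy j hj, sub_self]) (by simp), abs_mul,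
      abs_of_pos (inv_pos.2 hn'), inv_mul_eq_div]
    refine div_le_div_of_nonneg_right ((abs_sub _ _).trans ?_) hn'.le
    linarith [hF.bound f hf (x i), hF.bound f hf (y i)]
  -- Replacing one observation moves the deviation by at most `2 / n`; the variance proxy is `n * (2
  -- / n) ^ 2 = 4 / n`, hence the exponent `n * t ^ 2 / 8`.
  have h := (hasSubgaussianMGF_of_bounded_differences (μ := P) (f := dev F ν)
    hF.measurable_dev hF.bdd_dev (c := (2 / n : ℝ≥0)) fun i x y hxy => by
      push_cast
      rw [abs_le]
      have h1 := hdiff i x y hxy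
      have h2 := hdiff i y x fun j hj => (hxy j hj).symm
      constructor <;> linarith).measure_ge_le ht
  have hset : {x : Fin n → Vec p | (∫ y, dev F ν y ∂(Measure.pi fun _ : Fin n => P)) + t ≤ dev F ν x} =
      {x : Fin n → Vec p | t ≤ dev F ν x - ∫ y, dev F ν y ∂(Measure.pi fun _ : Fin n => P)} := by
    ext x
    simp only [Set.mem_ofPred_eq, le_sub_iff_add_le, add_comm]
  rw [hset]
  refine h.trans (le_of_eq ?_)
  congr 1
  push_cast
  field_simp
  ring

lemma measurePreserving_coord {α β : Type*} [MeasurableSpace α] [MeasurableSpace β] {μ : Measure α}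
    {κ : Measure β} [SigmaFinite κ] {g : α → β} (hg : MeasurePreserving g μ κ) :
    MeasurePreserving (fun (a : Fin n → α) i => g (a i)) (Measure.pi fun _ => μ)
      (Measure.pi fun _ => κ) :=
  measurePreserving_pi (fun _ => μ) (fun _ => κ) fun _ => hg

/-- The signed supremum whose average over signs is the Rademacher average. -/
def signSup (F : Set (Vec p → ℝ)) (ξ : Fin n → Bool) (x : Fin n → Vec p) : ℝ :=
  ⨆ f : F, |∑ i, sgn (ξ i) * f.1 (x i)|

lemma Regular.abs_signSum_le (hF : Regular B F) (ξ : Fin n → Bool) (x : Fin n → Vec p) (f : F) :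
    |∑ i, sgn (ξ i) * f.1 (x i)| ≤ n := by
  refine (Finset.abs_sum_le_sum_abs _ _).trans ((Finset.sum_le_sum (g := fun _ => (1 : ℝ))
    fun i _ => ?_).trans (by simp))
  rw [abs_mul, abs_sgn, one_mul]
  exact hF.bound f.1 f.2 _

lemma Regular.integrable_signSup (hF : Regular B F) (ξ : Fin n → Bool)
    {Q : Measure (Fin n → Vec p)} [IsFiniteMeasure Q] : Integrable (signSup F ξ) Q := by
  refine integrable_of_bdd (lowerSemicontinuous_ciSup_of_continuous
    (fun x => Bdd.abs ⟨n, hF.abs_signSum_le ξ x⟩) fun f => continuous_abs.comp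
      (continuous_finsetSum _ fun i _ => continuous_const.mul
        ((hF.continuous f.2).comp (continuous_apply i)))).measurable ⟨n, fun x => ?_⟩
  rw [signSup, abs_of_nonneg (Real.iSup_nonneg fun _ => abs_nonneg _)]
  exact Real.iSup_le (hF.abs_signSum_le ξ x) (by positivity)

lemma Regular.integrable_rad (hF : Regular B F) {Q : Measure (Fin n → Vec p)} [IsFiniteMeasure Q] :
    Integrable (rad F) Q :=
  (integrable_finsetSum _ fun ξ _ => hF.integrable_signSup ξ).const_mul _

lemma Regular.bdd_pairSup (hF : Regular B F) (z : Fin n → Vec p × Vec p) :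
    Bdd fun f : F => |∑ i, (f.1 (z i).1 - f.1 (z i).2)| := by
  refine Bdd.abs (Bdd.sum fun i => ?_)
  simpa only [sub_eq_add_neg] using (hF.bound.bdd _).add (hF.bound.bdd _).neg

/-- Symmetrization: the mean deviation is at most twice the Rademacher average. -/
theorem Regular.integral_dev_le (hF : Regular B F) (hn : 0 < n) (ν : Measure (Vec p))
    [IsProbabilityMeasure ν] :
    ∫ x, dev F ν x ∂(Measure.pi fun _ : Fin n => ν) ≤
      2 / n * ∫ x, rad F x ∂(Measure.pi fun _ : Fin n => ν) := by
  have hn' : (0 : ℝ) < n := by exact_mod_cast hn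
  set Q : Measure (Fin n → Vec p) := Measure.pi fun _ => ν with hQ
  set Q₂ : Measure (Fin n → Vec p × Vec p) := Measure.pi fun _ => ν.prod ν with hQ₂
  let G : (Fin n → Vec p × Vec p) → ℝ := fun z => ⨆ f : F, |∑ i, (f.1 (z i).1 - f.1 (z i).2)|
  have hGm : Measurable G :=
    (lowerSemicontinuous_ciSup_of_continuous hF.bdd_pairSup fun f =>
      continuous_abs.comp (continuous_finsetSum _ fun i _ =>
        (((hF.continuous f.2).comp continuous_fst).comp (continuous_apply i)).sub
          (((hF.continuous f.2).comp continuous_snd).comp (continuous_apply i)))).measurable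
  have hG0 : ∀ z, 0 ≤ G z := fun z => Real.iSup_nonneg fun _ => abs_nonneg _
  -- Swapping the two members of the `i`-th pair flips the sign of the `i`-th difference. The law of
  -- the pairs is invariant under such swaps, so signs may be inserted at will.
  have hG : ∀ (ξ : Fin n → Bool) (z z' : Fin n → Vec p × Vec p),
      (∀ i, z' i = if ξ i then z i else (z i).swap) →
      G z' ≤ signSup F ξ (fun i => (z i).1) + signSup F ξ (fun i => (z i).2) := by
    intro ξ z z' hz
    refine Real.iSup_le (fun f => ?_) (add_nonneg (Real.iSup_nonneg fun _ => abs_nonneg _)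
      (Real.iSup_nonneg fun _ => abs_nonneg _))
    have e : ∑ i, (f.1 (z' i).1 - f.1 (z' i).2) =
        ∑ i, sgn (ξ i) * f.1 (z i).1 - ∑ i, sgn (ξ i) * f.1 (z i).2 := by
      rw [← Finset.sum_sub_distrib]
      refine Finset.sum_congr rfl fun i _ => ?_
      rw [hz i]
      cases ξ i <;> simp [sgn]
      ring
    rw [e]
    refine (abs_sub _ _).trans (add_le_add ?_ ?_)
    · exact Bdd.le_ciSup (Bdd.abs ⟨n, hF.abs_signSum_le ξ fun i => (z i).1⟩) f
    · exact Bdd.le_ciSup (Bdd.abs ⟨n, hF.abs_signSum_le ξ fun i => (z i).2⟩) f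
  have hGb : Bdd G := by
    refine ⟨2 * n, fun z => ?_⟩
    rw [abs_of_nonneg (hG0 z)]
    refine (hG (fun _ => true) z z fun i => by simp).trans ?_
    have : ∀ x : Fin n → Vec p, signSup F (fun _ => true) x ≤ n := fun x =>
      Real.iSup_le (hF.abs_signSum_le _ x) (by positivity)
    linarith [this fun i => (z i).1, this fun i => (z i).2]
  have hswap : ∀ ξ : Fin n → Bool, ∫ z, G z ∂Q₂ ≤ 2 * ∫ x, signSup F ξ x ∂Q := by
    intro ξ
    have mp : MeasurePreserving
        (fun (z : Fin n → Vec p × Vec p) i => (if ξ i then id else Prod.swap) (z i)) Q₂ Q₂ := by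
      refine measurePreserving_pi (fun _ : Fin n => ν.prod ν) (fun _ => ν.prod ν)
        (f := fun i => if ξ i then id else Prod.swap) fun i => ?_
      cases ξ i
      · simpa using Measure.measurePreserving_swap (μ := ν) (ν := ν)
      · simpa using MeasurePreserving.id (ν.prod ν)
    have m1 : MeasurePreserving (fun (z : Fin n → Vec p × Vec p) i => (z i).1) Q₂ Q :=
      measurePreserving_coord measurePreserving_fst
    have m2 : MeasurePreserving (fun (z : Fin n → Vec p × Vec p) i => (z i).2) Q₂ Q :=
      measurePreserving_coord measurePreserving_snd
    have hs := hF.integrable_signSup ξ (Q := Q)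
    have i1 : Integrable (fun z : Fin n → Vec p × Vec p => signSup F ξ fun i => (z i).1) Q₂ :=
      m1.integrable_comp_of_integrable hs
    have i2 : Integrable (fun z : Fin n → Vec p × Vec p => signSup F ξ fun i => (z i).2) Q₂ :=
      m2.integrable_comp_of_integrable hs
    have e1 : ∫ z, signSup F ξ (fun i => (z i).1) ∂Q₂ = ∫ x, signSup F ξ x ∂Q := by
      rw [← m1.map_eq, integral_map m1.measurable.aemeasurable]
      rw [m1.map_eq]; exact hs.aestronglyMeasurable
    have e2 : ∫ z, signSup F ξ (fun i => (z i).2) ∂Q₂ = ∫ x, signSup F ξ x ∂Q := by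
      rw [← m2.map_eq, integral_map m2.measurable.aemeasurable]
      rw [m2.map_eq]; exact hs.aestronglyMeasurable
    calc ∫ z, G z ∂Q₂
        = ∫ z, G (fun i => (if ξ i then id else Prod.swap) (z i)) ∂Q₂ := by
          conv_lhs => rw [← mp.map_eq]
          rw [integral_map mp.measurable.aemeasurable hGm.aestronglyMeasurable]
      _ ≤ ∫ z, (signSup F ξ (fun i => (z i).1) + signSup F ξ (fun i => (z i).2)) ∂Q₂ := by
          refine integral_mono (integrable_of_bdd (hGm.comp mp.measurable) ?_) (i1.add i2)
            fun z => hG ξ z _ fun i => ?_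
          · obtain ⟨C, hC⟩ := hGb
            exact ⟨C, fun z => hC _⟩
          · cases ξ i <;> simp
      _ = _ := by rw [integral_add i1 i2, e1, e2]; ring
  have hrad : ∫ z, G z ∂Q₂ ≤ 2 * ∫ x, rad F x ∂Q := by
    have e : ∫ x, rad F x ∂Q = (2 ^ n : ℝ)⁻¹ * ∑ ξ : Fin n → Bool, ∫ x, signSup F ξ x ∂Q := by
      rw [← integral_finsetSum _ fun ξ _ => hF.integrable_signSup ξ, ← integral_const_mul]
      rfl
    have hs : ∑ _ξ : Fin n → Bool, ∫ z, G z ∂Q₂ ≤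
        ∑ ξ : Fin n → Bool, 2 * ∫ x, signSup F ξ x ∂Q := Finset.sum_le_sum fun ξ _ => hswap ξ
    rw [Finset.sum_const, Finset.card_univ, Fintype.card_fun, Fintype.card_bool, Fintype.card_fin,
      nsmul_eq_mul, ← Finset.mul_sum] at hs
    push_cast at hs
    rw [e, mul_left_comm, le_inv_mul_iff₀ (by positivity)]
    exact hs
  -- Ghost sample: the exact mean is the expected empirical mean of an independent copy, and the
  -- integral over the copy can be moved outside the supremum at the price of an inequality.
  have hpair : ∫ x, dev F ν x ∂Q ≤ (n : ℝ)⁻¹ * ∫ z, G z ∂Q₂ := by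
    have mp := (measurePreserving_arrowProdEquivProdArrow (Vec p) (Vec p) (Fin n)
      (fun _ => ν) (fun _ => ν)).symm
    set e := (MeasurableEquiv.arrowProdEquivProdArrow (Vec p) (Vec p) (Fin n)).symm with he
    have hGe : Bdd fun z => G (e z) := by
      obtain ⟨C, hC⟩ := hGb
      exact ⟨C, fun z => hC _⟩
    have hGi : Integrable (fun z => G (e z)) (Q.prod Q) :=
      integrable_of_bdd (hGm.comp e.measurable) hGe
    have hGx : ∀ x, Integrable (fun y => G (e (x, y))) Q := fun x =>
      integrable_of_bdd ((hGm.comp e.measurable).comp measurable_prodMk_left) (by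
        obtain ⟨C, hC⟩ := hGe
        exact ⟨C, fun y => hC _⟩)
    rw [← mp.integral_comp e.measurableEmbedding, ← integral_const_mul]
    rw [show (Measure.pi fun _ : Fin n => ν).prod (Measure.pi fun _ : Fin n => ν) = Q.prod Q from rfl,
      integral_prod _ (hGi.const_mul _)]
    refine integral_mono (integrable_of_bdd hF.measurable_dev hF.bdd_dev)
      (hGi.const_mul _).integral_prod_left fun x => ?_
    simp only
    rw [integral_const_mul]
    refine Real.iSup_le (fun f => ?_) (mul_nonneg (by positivity)
      (integral_nonneg fun y => hG0 _))
    have hfi : ∀ i, Integrable (fun y : Fin n → Vec p => f.1 (y i)) Q := fun i =>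
      integrable_of_bdd ((hF.continuous f.2).measurable.comp (measurable_pi_apply i))
        ⟨1, fun y => hF.bound _ f.2 _⟩
    have hfe : ∀ i, ∫ y, f.1 (y i) ∂Q = ∫ y, f.1 y ∂ν := fun i => by
      have := measurePreserving_eval (fun _ : Fin n => ν) i
      rw [← this.map_eq, integral_map this.measurable.aemeasurable
        (hF.continuous f.2).aestronglyMeasurable]
    have e1 : (n : ℝ)⁻¹ * ∑ i, f.1 (x i) - ∫ y, f.1 y ∂ν =
        (n : ℝ)⁻¹ * ∫ y, ∑ i, (f.1 (x i) - f.1 (y i)) ∂Q := by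
      have hsub : ∀ i, Integrable (fun y : Fin n → Vec p => f.1 (x i) - f.1 (y i)) Q :=
        fun i => (integrable_const _).sub (hfi i)
      rw [integral_finsetSum _ fun i _ => hsub i]
      simp only [integral_sub (integrable_const _) (hfi _), hfe, Finset.sum_sub_distrib]
      simp
      field_simp
    rw [e1, abs_mul, abs_of_pos (inv_pos.2 hn')]
    refine mul_le_mul_of_nonneg_left ?_ (inv_pos.2 hn').le
    rw [← Real.norm_eq_abs]
    refine norm_integral_le_of_norm_le (hGx x) (Filter.Eventually.of_forall fun y => ?_)
    exact (hF.bdd_pairSup (e (x, y))).le_ciSup f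
  calc ∫ x, dev F ν x ∂Q ≤ (n : ℝ)⁻¹ * ∫ z, G z ∂Q₂ := hpair
    _ ≤ (n : ℝ)⁻¹ * (2 * ∫ x, rad F x ∂Q) := mul_le_mul_of_nonneg_left hrad (by positivity)
    _ = _ := by ring

/-- The effect of contamination in Wasserstein distance on the mean deviation. -/
theorem Regular.integral_dev_le_of_W1 (hF : Regular B F) (hB : 0 ≤ B) (hn : 0 < n)
    {P : Measure (Vec p)} [IsProbabilityMeasure P] [IsProbabilityMeasure ν] {ε : ℝ} (hε : 0 ≤ ε)
    (hW : W1 P ν ≤ ENNReal.ofReal ε) :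
    ∫ x, dev F ν x ∂(Measure.pi fun _ : Fin n => P) ≤
      (∫ x, dev F ν x ∂(Measure.pi fun _ : Fin n => ν)) + B * ε := by
  have hn' : (0 : ℝ) < n := by exact_mod_cast hn
  -- An optimal coupling need not be exhibited: any `δ > ε` admits a coupling of cost below `δ`, and
  -- then `δ` tends to `ε`.
  suffices h : ∀ δ > ε, ∫ x, dev F ν x ∂(Measure.pi fun _ : Fin n => P) ≤
      (∫ x, dev F ν x ∂(Measure.pi fun _ : Fin n => ν)) + B * δ by
    refine ge_of_tendsto (x := nhdsWithin ε (Set.Ioi ε))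
      (f := fun δ => (∫ x, dev F ν x ∂(Measure.pi fun _ : Fin n => ν)) + B * δ) ?_ ?_
    · have : Continuous fun δ => (∫ x, dev F ν x ∂(Measure.pi fun _ : Fin n => ν)) + B * δ := by
        fun_prop
      exact this.continuousWithinAt
    · filter_upwards [self_mem_nhdsWithin] with δ hδ using h δ hδ
  intro δ hδ
  have hlt : W1 P ν < ENNReal.ofReal δ :=
    hW.trans_lt ((ENNReal.ofReal_lt_ofReal_iff (hε.trans_lt hδ)).2 hδ)
  simp only [W1, iInf_lt_iff] at hlt
  obtain ⟨π, ⟨h1, h2⟩, hcost⟩ := hlt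
  have : IsProbabilityMeasure π := ⟨by
    rw [← Measure.fst_univ, h1]; exact measure_univ⟩
  have q1 : MeasurePreserving (Prod.fst : Vec p × Vec p → Vec p) π P := ⟨measurable_fst, h1⟩
  have q2 : MeasurePreserving (Prod.snd : Vec p × Vec p → Vec p) π ν := ⟨measurable_snd, h2⟩
  -- Independent copies of the coupling produce a contaminated and a clean sample on one space. By
  -- the Lipschitz bound their deviations differ by at most `B` times the average distance.
  set Q : Measure (Fin n → Vec p × Vec p) := Measure.pi fun _ => π with hQ
  have m1 : MeasurePreserving (fun (z : Fin n → Vec p × Vec p) i => (z i).1) Q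
      (Measure.pi fun _ => P) := measurePreserving_coord q1
  have m2 : MeasurePreserving (fun (z : Fin n → Vec p × Vec p) i => (z i).2) Q
      (Measure.pi fun _ => ν) := measurePreserving_coord q2
  have hdm : Measurable (fun z : Vec p × Vec p => ‖z.1 - z.2‖) := by fun_prop
  have hlint : ∫⁻ z, ‖‖z.1 - z.2‖‖ₑ ∂π < ENNReal.ofReal δ := by
    simpa [edist_eq_enorm_sub] using hcost
  have hdi : Integrable (fun z : Vec p × Vec p => ‖z.1 - z.2‖) π :=
    ⟨hdm.aestronglyMeasurable, hlint.trans ENNReal.ofReal_lt_top⟩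
  have hdδ : ∫ z, ‖z.1 - z.2‖ ∂π ≤ δ := by
    have := (ofReal_integral_norm_eq_lintegral_enorm hdi).trans_lt hlint
    simp only [norm_norm] at this
    exact ((ENNReal.ofReal_lt_ofReal_iff (hε.trans_lt hδ)).1 this).le
  have hev : ∀ i, MeasurePreserving (Function.eval i) Q π := fun i =>
    measurePreserving_eval (fun _ : Fin n => π) i
  have hdi' : ∀ i, Integrable (fun z : Fin n → Vec p × Vec p => ‖(z i).1 - (z i).2‖) Q :=
    fun i => (hev i).integrable_comp_of_integrable hdi
  have hde : ∀ i, ∫ z, ‖(z i).1 - (z i).2‖ ∂Q = ∫ z, ‖z.1 - z.2‖ ∂π := fun i => by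
    rw [← (hev i).map_eq, integral_map (hev i).measurable.aemeasurable hdm.aestronglyMeasurable]
  have e1 : ∫ x, dev F ν x ∂(Measure.pi fun _ : Fin n => P) =
      ∫ z, dev F ν (fun i => (z i).1) ∂Q := by
    rw [← m1.map_eq, integral_map m1.measurable.aemeasurable hF.measurable_dev.aestronglyMeasurable]
  have e2 : ∫ x, dev F ν x ∂(Measure.pi fun _ : Fin n => ν) =
      ∫ z, dev F ν (fun i => (z i).2) ∂Q := by
    rw [← m2.map_eq, integral_map m2.measurable.aemeasurable hF.measurable_dev.aestronglyMeasurable]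
  have hdevi : Integrable (dev F ν : (Fin n → Vec p) → ℝ) (Measure.pi fun _ => P) :=
    integrable_of_bdd hF.measurable_dev hF.bdd_dev
  have hdevi' : Integrable (dev F ν : (Fin n → Vec p) → ℝ) (Measure.pi fun _ => ν) :=
    integrable_of_bdd hF.measurable_dev hF.bdd_dev
  have hd2 : Integrable (fun z : Fin n → Vec p × Vec p => dev F ν fun i => (z i).2) Q :=
    m2.integrable_comp_of_integrable hdevi'
  have hsum : Integrable (fun z : Fin n → Vec p × Vec p =>
      B * ((n : ℝ)⁻¹ * ∑ i, ‖(z i).1 - (z i).2‖)) Q :=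
    ((integrable_finsetSum _ fun i _ => hdi' i).const_mul _).const_mul _
  rw [e1, e2]
  calc ∫ z, dev F ν (fun i => (z i).1) ∂Q
      ≤ ∫ z, (dev F ν (fun i => (z i).2) + B * ((n : ℝ)⁻¹ * ∑ i, ‖(z i).1 - (z i).2‖)) ∂Q := by
        refine integral_mono (m1.integrable_comp_of_integrable hdevi) (hd2.add hsum) fun z => ?_
        refine hF.dev_le_add (by positivity) fun f hf => ?_
        rw [abs_mul, abs_of_pos (inv_pos.2 hn'), mul_left_comm]
        refine mul_le_mul_of_nonneg_left ((Finset.abs_sum_le_sum_abs _ _).trans ?_) (by positivity)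
        rw [Finset.mul_sum]
        exact Finset.sum_le_sum fun i _ => hF.lip f hf _ _
    _ = (∫ z, dev F ν (fun i => (z i).2) ∂Q) + B * ∫ z, ‖z.1 - z.2‖ ∂π := by
        rw [integral_add hd2 hsum, integral_const_mul, integral_const_mul,
          integral_finsetSum _ fun i _ => hdi' i]
        simp only [hde]
        simp
        field_simp
        simp
    _ ≤ _ := by gcongr

end Deviation

/-! ### Exponential moments of Gaussian sign sums. -/

section Gaussian

variable {p n : ℕ}

/-- The quadratic form `wᵀ S w`. -/
def quad (S : Matrix (Fin p) (Fin p) ℝ) (w : Vec p) : ℝ := w.ofLp ⬝ᵥ S.mulVec w.ofLp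

lemma map_inner_multivariateGaussian {S : Matrix (Fin p) (Fin p) ℝ} (hS : S.PosSemidef)
    (w : Vec p) :
    (multivariateGaussian 0 S).map (fun y : Vec p => inner ℝ w y) =
      gaussianReal 0 (quad S w).toNNReal := by
  have h := IsGaussian.map_eq_gaussianReal (μ := multivariateGaussian 0 S) (innerSL ℝ w)
  have h1 : ∫ y, innerSL ℝ w y ∂(multivariateGaussian (0 : Vec p) S) = 0 := by
    rw [ContinuousLinearMap.integral_comp_id_comm IsGaussian.integrable_id]
    simp
  have h2 : Var[innerSL ℝ w; multivariateGaussian (0 : Vec p) S] = quad S w := by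
    have := covarianceBilin_self (μ := multivariateGaussian (0 : Vec p) S)
      IsGaussian.memLp_two_id w
    rw [covarianceBilin_multivariateGaussian hS] at this
    exact this.symm
  rw [h1, h2] at h
  exact h

lemma quad_nonneg {S : Matrix (Fin p) (Fin p) ℝ} (hS : S.PosSemidef) (w : Vec p) :
    0 ≤ quad S w := by
  simpa [quad] using hS.dotProduct_mulVec_nonneg w.ofLp

lemma integrable_exp_inner {S : Matrix (Fin p) (Fin p) ℝ} (hS : S.PosSemidef) (w : Vec p)
    (t : ℝ) :
    Integrable (fun y : Vec p => Real.exp (t * inner ℝ w y)) (multivariateGaussian 0 S) := by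
  have h := integrable_exp_mul_gaussianReal (μ := 0) (v := (quad S w).toNNReal) t
  rw [← map_inner_multivariateGaussian hS, integrable_map_measure
    (Continuous.aestronglyMeasurable (by fun_prop)) (by fun_prop)] at h
  exact h

lemma integral_exp_inner {S : Matrix (Fin p) (Fin p) ℝ} (hS : S.PosSemidef) (w : Vec p)
    (t : ℝ) :
    ∫ y : Vec p, Real.exp (t * inner ℝ w y) ∂(multivariateGaussian 0 S) =
      Real.exp (quad S w * t ^ 2 / 2) := by
  have h := mgf_gaussianReal (map_inner_multivariateGaussian hS w) t
  simpa [mgf, Real.coe_toNNReal _ (quad_nonneg hS w)] using h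

lemma lintegral_pi_prod_ofReal {κ : Type*} [Fintype κ] {E : Type*} [MeasurableSpace E]
    {μ : Measure E} [SigmaFinite μ] {f : κ → E → ℝ} (hf : ∀ i, Integrable (f i) μ)
    (h0 : ∀ i x, 0 ≤ f i x) :
    ∫⁻ x, ENNReal.ofReal (∏ i, f i (x i)) ∂(Measure.pi fun _ : κ => μ) =
      ENNReal.ofReal (∏ i, ∫ x, f i x ∂μ) := by
  rw [← ofReal_integral_eq_lintegral_ofReal (Integrable.fintype_prod hf)
    (Filter.Eventually.of_forall fun x => Finset.prod_nonneg fun i _ => h0 i _),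
    integral_fintype_prod_eq_prod]

/-- The Gaussian moment generating function sees only squares of the signs, so the value is that of
a centered Gaussian with covariance `n • S`, whatever `ξ` is. -/
lemma lintegral_exp_inner_signSum {S : Matrix (Fin p) (Fin p) ℝ} (hS : S.PosSemidef) (w : Vec p)
    (ξ : Fin n → Bool) :
    ∫⁻ x : Fin n → Vec p, ENNReal.ofReal (Real.exp (inner ℝ w (∑ i, sgn (ξ i) • x i)))
      ∂(Measure.pi fun _ => multivariateGaussian 0 S) =
      ENNReal.ofReal (Real.exp (n * (quad S w / 2))) := by
  have h := lintegral_pi_prod_ofReal (μ := multivariateGaussian (0 : Vec p) S)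
    (f := fun (i : Fin n) y => Real.exp (sgn (ξ i) * inner ℝ w y))
    (fun i => integrable_exp_inner hS w _) (fun i y => (Real.exp_pos _).le)
  simp only [integral_exp_inner hS, ← Real.exp_sum, sq, sgn_mul_self] at h
  simp only [inner_sum, inner_smul_right]
  rw [h]
  simp

lemma gaussianPDFReal_smul_exp_quarter_sq (x : ℝ) :
    gaussianPDFReal 0 1 x • Real.exp (x ^ 2 / 4) =
      (Real.sqrt (2 * Real.pi))⁻¹ * Real.exp (-(1 / 4) * x ^ 2) := by
  simp only [gaussianPDFReal, NNReal.coe_one, mul_one, sub_zero, smul_eq_mul]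
  rw [mul_assoc, ← Real.exp_add]
  congr 2
  ring

/-- The exact value is `√2`; rounding it up to 2 produces the factor `2 ^ T.card` in
`lintegral_exp_block_le`. -/
lemma integral_exp_quarter_sq_le : ∫ h, Real.exp (h ^ 2 / 4) ∂(gaussianReal 0 1) ≤ 2 := by
  rw [integral_gaussianReal_eq_integral_smul one_ne_zero]
  simp only [gaussianPDFReal_smul_exp_quarter_sq]
  rw [integral_const_mul, integral_gaussian, ← Real.sqrt_inv, ← Real.sqrt_mul (by positivity)]
  refine Real.sqrt_le_iff.2 ⟨by norm_num, ?_⟩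
  have := Real.pi_pos
  field_simp
  norm_num

lemma integrable_exp_quarter_sq : Integrable (fun h => Real.exp (h ^ 2 / 4)) (gaussianReal 0 1) := by
  rw [gaussianReal_of_var_ne_zero _ one_ne_zero,
    integrable_withDensity_iff_integrable_smul' (measurable_gaussianPDF _ _)
      (Filter.Eventually.of_forall fun _ => gaussianPDF_lt_top)]
  simp only [toReal_gaussianPDF]
  simp only [gaussianPDFReal_smul_exp_quarter_sq]
  exact (integrable_exp_neg_mul_sq (by norm_num)).const_mul _

/-- Exponential moment of the squared norm of a block of `∑ ξᵢ Yᵢ`, with `Yᵢ` independent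
centered Gaussian vectors. -/
theorem lintegral_exp_block_le {S : Matrix (Fin p) (Fin p) ℝ} (hS : S.PosSemidef) {M : ℝ}
    (hM : 0 < M) (hSM : ∀ w, quad S w ≤ M * ‖w‖ ^ 2) (hn : 0 < n) (ξ : Fin n → Bool)
    (T : Finset (Fin p)) :
    ∫⁻ x : Fin n → Vec p, ENNReal.ofReal
        (Real.exp ((4 * n * M)⁻¹ * ∑ i ∈ T, (∑ j, sgn (ξ j) • x j : Vec p) i ^ 2))
      ∂(Measure.pi fun _ => multivariateGaussian 0 S) ≤ ENNReal.ofReal (2 ^ T.card) := by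
  have hn' : (0 : ℝ) < n := by exact_mod_cast hn
  set N := multivariateGaussian (0 : Vec p) S with hN
  set γ : Measure (Fin p → ℝ) := Measure.pi fun _ => gaussianReal 0 1 with hγ
  let g : (Fin n → Vec p) → Vec p := fun x => ∑ j, sgn (ξ j) • x j
  have hg : Continuous g := by fun_prop
  -- Gaussian linearization: `exp (c ^ 2 * y ^ 2 / 2)` is the mean of `exp (c * y * h)` over a
  -- standard Gaussian `h`. With `c ^ 2 = 1 / (2nM)` on `T` this reproduces the weight `1 / (4nM)`;
  -- after exchanging the integrals the exponent is at most the sum over `T` of `h i ^ 2 / 4`.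
  let c : Fin p → ℝ := fun i => if i ∈ T then Real.sqrt ((2 * n * M)⁻¹) else 0
  have hc : ∀ i, c i ^ 2 = if i ∈ T then (2 * n * M)⁻¹ else 0 := by
    intro i
    simp only [c]
    split_ifs
    · exact Real.sq_sqrt (by positivity)
    · simp
  let w : (Fin p → ℝ) → Vec p := fun h => WithLp.toLp 2 fun i => c i * h i
  have hw : Continuous w := (PiLp.continuous_toLp 2 _).comp (by fun_prop)
  have hinner : ∀ h y, inner ℝ (w h) y = ∑ i, (c i * y i) * h i := by
    intro h y
    simp only [PiLp.inner_apply, w]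
    refine Finset.sum_congr rfl fun i _ => ?_
    simp
    ring
  have e1 : ∀ y : Vec p, ENNReal.ofReal (Real.exp ((4 * n * M)⁻¹ * ∑ i ∈ T, y i ^ 2)) =
      ∫⁻ h, ENNReal.ofReal (Real.exp (inner ℝ (w h) y)) ∂γ := by
    intro y
    have h := lintegral_pi_prod_ofReal (μ := gaussianReal 0 1)
      (f := fun (i : Fin p) h => Real.exp ((c i * y i) * h))
      (fun i => integrable_exp_mul_gaussianReal _) (fun i y => (Real.exp_pos _).le)
    have hm : ∀ t : ℝ, ∫ h, Real.exp (t * h) ∂(gaussianReal 0 1) = Real.exp (t ^ 2 / 2) := by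
      intro t
      have := congrFun (mgf_id_gaussianReal (μ := 0) (v := 1)) t
      simpa [mgf] using this
    simp only [hm, ← Real.exp_sum] at h
    simp only [hinner]
    rw [h]
    congr 2
    have hi : ∀ i, (c i * y i) ^ 2 / 2 = if i ∈ T then (4 * n * M)⁻¹ * y i ^ 2 else 0 := by
      intro i
      rw [mul_pow, hc]
      split_ifs
      · field_simp
        ring
      · simp
    simp only [hi, Finset.sum_ite_mem, Finset.univ_inter, Finset.mul_sum]
  calc ∫⁻ x : Fin n → Vec p, ENNReal.ofReal (Real.exp ((4 * n * M)⁻¹ * ∑ i ∈ T, g x i ^ 2))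
        ∂(Measure.pi fun _ => N)
      = ∫⁻ x : Fin n → Vec p, ∫⁻ h, ENNReal.ofReal (Real.exp (inner ℝ (w h) (g x))) ∂γ
        ∂(Measure.pi fun _ => N) := by simp only [e1]
    _ = ∫⁻ h, ∫⁻ x : Fin n → Vec p, ENNReal.ofReal (Real.exp (inner ℝ (w h) (g x)))
        ∂(Measure.pi fun _ => N) ∂γ := by
        refine lintegral_lintegral_swap (Measurable.aemeasurable ?_)
        refine ENNReal.measurable_ofReal.comp (Continuous.measurable ?_)
        exact Real.continuous_exp.comp ((hw.comp continuous_snd).inner (hg.comp continuous_fst))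
    _ = ∫⁻ h, ENNReal.ofReal (Real.exp (n * (quad S (w h) / 2))) ∂γ := by
        simp only [g, hN, lintegral_exp_inner_signSum hS]
    _ ≤ ∫⁻ h, ENNReal.ofReal (∏ i, if i ∈ T then Real.exp (h i ^ 2 / 4) else 1) ∂γ := by
        refine lintegral_mono fun h => ENNReal.ofReal_le_ofReal ?_
        have e2 : ∏ i, (if i ∈ T then Real.exp (h i ^ 2 / 4) else 1) =
            Real.exp (∑ i, if i ∈ T then h i ^ 2 / 4 else 0) := by
          rw [Real.exp_sum]
          refine Finset.prod_congr rfl fun i _ => ?_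
          split_ifs <;> simp
        rw [e2, Real.exp_le_exp]
        have e3 : (n : ℝ) * (M * ‖w h‖ ^ 2 / 2) = ∑ i, if i ∈ T then h i ^ 2 / 4 else 0 := by
          rw [EuclideanSpace.real_norm_sq_eq, Finset.mul_sum, Finset.sum_div, Finset.mul_sum]
          refine Finset.sum_congr rfl fun i _ => ?_
          simp only [w, mul_pow, hc]
          split_ifs
          · field_simp
            ring
          · simp
        rw [← e3]
        have := hSM (w h)
        gcongr
    _ = ENNReal.ofReal (∏ i, if i ∈ T then ∫ h, Real.exp (h ^ 2 / 4) ∂(gaussianReal 0 1) else 1) := by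
        have h := lintegral_pi_prod_ofReal (μ := gaussianReal 0 1)
          (f := fun (i : Fin p) h => if i ∈ T then Real.exp (h ^ 2 / 4) else 1) (fun i => by
            split_ifs
            · exact integrable_exp_quarter_sq
            · exact integrable_const _) (fun i y => by
            split_ifs
            · exact (Real.exp_pos _).le
            · exact zero_le_one)
        rw [h]
        congr 1
        refine Finset.prod_congr rfl fun i _ => ?_
        split_ifs <;> simp
    _ ≤ ENNReal.ofReal (2 ^ T.card) := by
        refine ENNReal.ofReal_le_ofReal ?_
        rw [Finset.prod_ite_mem, Finset.univ_inter, Finset.prod_const]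
        exact pow_le_pow_left₀ (integral_nonneg fun _ => (Real.exp_pos _).le)
          integral_exp_quarter_sq_le _

end Gaussian

/-! ### Sparse linear functions over a Gaussian sample. -/

section SparseLinear

variable {p n : ℕ}

/-- The number of supports times the exponential moment of one block. Each factor is at most `exp (s
+ s * log (p / s))`: the first by `p.choose s ≤ p ^ s / s!` and `s ^ s / s! ≤ exp s`, the second by
`2 ≤ exp 1`. -/
lemma choose_mul_two_pow_le {p s : ℕ} (hs : 1 ≤ s) (hsp : s ≤ p) :
    (p.choose s : ℝ) * 2 ^ s ≤ Real.exp (2 * (s + s * Real.log (p / s))) := by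
  have hs' : (0 : ℝ) < s := by exact_mod_cast hs
  have hp' : (s : ℝ) ≤ p := by exact_mod_cast hsp
  have hlog : 0 ≤ Real.log ((p : ℝ) / s) := Real.log_nonneg ((one_le_div hs').2 hp')
  have h1 : (p.choose s : ℝ) ≤ Real.exp (s + s * Real.log (p / s)) := by
    calc (p.choose s : ℝ) ≤ (p : ℝ) ^ s / s.factorial := Nat.choose_le_pow_div s p
      _ = ((p : ℝ) / s) ^ s * ((s : ℝ) ^ s / s.factorial) := by
          rw [div_pow]
          field_simp
      _ ≤ ((p : ℝ) / s) ^ s * Real.exp s :=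
          mul_le_mul_of_nonneg_left (Real.pow_div_factorial_le_exp _ hs'.le s) (by positivity)
      _ = Real.exp (s + s * Real.log (p / s)) := by
          rw [Real.exp_add, mul_comm (s : ℝ) (Real.log _), Real.exp_mul, Real.exp_log
            (div_pos (hs'.trans_le hp') hs'), Real.rpow_natCast, mul_comm]
  have h2 : (2 : ℝ) ^ s ≤ Real.exp (s + s * Real.log (p / s)) := by
    calc (2 : ℝ) ^ s ≤ Real.exp 1 ^ s :=
          pow_le_pow_left₀ zero_le_two (by linarith [Real.add_one_le_exp 1]) _
      _ = Real.exp s := by rw [← Real.exp_nat_mul, mul_one]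
      _ ≤ _ := Real.exp_le_exp.2 (by linarith [mul_nonneg hs'.le hlog])
  calc _ ≤ _ := mul_le_mul h1 h2 (by positivity) (Real.exp_pos _).le
    _ = _ := by rw [← Real.exp_add]; ring_nf

lemma abs_inner_le_of_support {w g : Vec p} {T : Finset (Fin p)} (hT : ∀ i, w i ≠ 0 → i ∈ T) :
    |inner ℝ w g| ≤ ‖w‖ * Real.sqrt (∑ i ∈ T, g i ^ 2) := by
  have h1 : inner ℝ w g = ∑ i ∈ T, w i * g i := by
    rw [PiLp.inner_apply]
    symm
    refine (Finset.sum_subset (Finset.subset_univ T) fun i _ hi => ?_).trans ?_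
    · rw [not_not.1 (mt (hT i) hi), zero_mul]
    · exact Finset.sum_congr rfl fun i _ => by simp [mul_comm]
  have h2 : ∑ i ∈ T, w i ^ 2 ≤ ‖w‖ ^ 2 := by
    rw [EuclideanSpace.real_norm_sq_eq]
    exact Finset.sum_le_univ_sum_of_nonneg fun i => sq_nonneg _
  rw [h1, ← Real.sqrt_sq (norm_nonneg w), ← Real.sqrt_mul (sq_nonneg _)]
  refine Real.abs_le_sqrt ((Finset.sum_mul_sq_le_sq_mul_sq T _ _).trans ?_)
  exact mul_le_mul_of_nonneg_right h2 (Finset.sum_nonneg fun i _ => sq_nonneg _)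

lemma exists_support_superset {w : Vec p} {s : ℕ} (hw : {i | w i ≠ 0}.ncard ≤ s) (hsp : s ≤ p) :
    ∃ T ∈ (Finset.univ : Finset (Fin p)).powersetCard s, ∀ i, w i ≠ 0 → i ∈ T := by
  classical
  have hc : (Finset.univ.filter fun i => w i ≠ 0).card ≤ s := by
    rw [← Set.ncard_coe_finset]
    simpa using hw
  obtain ⟨T, h1, -, h2⟩ := Finset.exists_subsuperset_card_eq
    (Finset.subset_univ (Finset.univ.filter fun i => w i ≠ 0)) hc (by simpa using hsp)
  exact ⟨T, Finset.mem_powersetCard.2 ⟨Finset.subset_univ _, h2⟩, fun i hi => h1 (by simpa using hi)⟩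

/-- A pointwise substitute for Jensen's inequality. The AM-GM inequality makes `√q` linear in `q`,
and `x + 1 ≤ exp x` at `x = lam * q - r` bounds `q` by an exponential, which can be integrated and
summed over supports. -/
lemma linear_le_of_exp {b u q r c lam : ℝ} (hb : 0 < b) (hc : 0 < c) (hl : 0 < lam) (hq : 0 ≤ q)
    (hu : Real.exp (lam * q) ≤ u) :
    b * Real.sqrt q ≤ c / 2 + b ^ 2 / (2 * c * lam) * (r - 1 + Real.exp (-r) * u) := by
  have h1 : lam * q ≤ r - 1 + Real.exp (-r) * u := by
    have h2 := Real.add_one_le_exp (-r + lam * q)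
    rw [Real.exp_add] at h2
    have := mul_le_mul_of_nonneg_left hu (Real.exp_pos (-r)).le
    linarith
  have h3 : b * Real.sqrt q ≤ c / 2 + b ^ 2 / (2 * c) * q := by
    have h4 : b ^ 2 * q = (b * Real.sqrt q) ^ 2 := by rw [mul_pow, Real.sq_sqrt hq]
    rw [div_mul_eq_mul_div, h4, div_add_div _ _ two_ne_zero (by positivity), le_div_iff₀ (by positivity)]
    nlinarith [sq_nonneg (c - b * Real.sqrt q)]
  refine h3.trans (add_le_add le_rfl ?_)
  have h5 : b ^ 2 / (2 * c) * q = b ^ 2 / (2 * c * lam) * (lam * q) := by field_simp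
  rw [h5]
  exact mul_le_mul_of_nonneg_left h1 (by positivity)

lemma integral_const_add_mul {α : Type*} [MeasurableSpace α] {μ : Measure α}
    [IsProbabilityMeasure μ] {f : α → ℝ} (hf : Integrable f μ) (a b : ℝ) :
    ∫ x, (a + b * f x) ∂μ = a + b * ∫ x, f x ∂μ := by
  rw [integral_add (integrable_const _) (hf.const_mul _), integral_const_mul]
  simp

/-- Integrable majorant for the Rademacher average of sparse linear functions over a Gaussian
sample. -/
theorem exists_majorant_radAvg_linear {S : Matrix (Fin p) (Fin p) ℝ} (hS : S.PosSemidef) {M : ℝ}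
    (hM : 0 < M) (hSM : ∀ w, quad S w ≤ M * ‖w‖ ^ 2) (hn : 0 < n) {B : ℝ} (hB : 0 < B) {s : ℕ}
    (hs : 1 ≤ s) (hsp : s ≤ p) :
    ∃ Ψ : (Fin n → Vec p) → ℝ,
      Integrable Ψ (Measure.pi fun _ => multivariateGaussian 0 S) ∧
      (∀ x, radAvg (fun i (w : sparseBall p B s) => inner ℝ w.1 (x i)) ≤ Ψ x) ∧
      ∫ x, Ψ x ∂(Measure.pi fun _ => multivariateGaussian 0 S) ≤
        B * Real.sqrt (8 * n * M * (s + s * Real.log (p / s))) := by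
  have hn' : (0 : ℝ) < n := by exact_mod_cast hn
  have hs' : (0 : ℝ) < s := by exact_mod_cast hs
  have hp' : (s : ℝ) ≤ p := by exact_mod_cast hsp
  have hlog : 0 ≤ Real.log ((p : ℝ) / s) := Real.log_nonneg ((one_le_div hs').2 hp')
  set r : ℝ := s + s * Real.log (p / s) with hr
  have hr0 : 0 < r := by positivity
  set Q : Measure (Fin n → Vec p) := Measure.pi fun _ => multivariateGaussian 0 S with hQ
  -- The target bound itself serves as the AM-GM parameter: since `c ^ 2 = 8nMrB ^ 2` and `1 / lam =
  -- 4nM`, the second term integrates to at most `c / 2` as well.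
  set c : ℝ := B * Real.sqrt (8 * n * M * r) with hc
  have hc0 : 0 < c := by positivity
  have hc2 : c ^ 2 = B ^ 2 * (8 * n * M * r) := by
    rw [hc, mul_pow, Real.sq_sqrt (by positivity)]
  set lam : ℝ := (4 * n * M)⁻¹ with hlam
  have hlam0 : 0 < lam := by positivity
  let 𝒯 := (Finset.univ : Finset (Fin p)).powersetCard s
  let e : (Fin n → Bool) → Finset (Fin p) → (Fin n → Vec p) → ℝ := fun ξ T x =>
    Real.exp (lam * ∑ i ∈ T, (∑ j, sgn (ξ j) • x j : Vec p) i ^ 2)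
  have he : ∀ ξ T, Integrable (e ξ T) Q ∧ ∫ x, e ξ T x ∂Q ≤ 2 ^ T.card := by
    intro ξ T
    have hcont : Continuous (e ξ T) := by
      refine Real.continuous_exp.comp (continuous_const.mul (continuous_finsetSum _ fun i _ => ?_))
      have : Continuous fun x : Fin n → Vec p => (∑ j, sgn (ξ j) • x j : Vec p) := by fun_prop
      exact ((PiLp.continuous_apply 2 _ i).comp this).pow 2
    have h0 : ∀ᵐ x ∂Q, 0 ≤ e ξ T x := Filter.Eventually.of_forall fun x => (Real.exp_pos _).le
    have hle : ∫⁻ x, ENNReal.ofReal (e ξ T x) ∂Q ≤ ENNReal.ofReal (2 ^ T.card) :=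
      lintegral_exp_block_le hS hM hSM hn ξ T
    have hi : Integrable (e ξ T) Q :=
      (lintegral_ofReal_ne_top_iff_integrable hcont.aestronglyMeasurable h0).1
        (hle.trans_lt ENNReal.ofReal_lt_top).ne
    refine ⟨hi, ?_⟩
    rw [← ofReal_integral_eq_lintegral_ofReal hi h0] at hle
    exact (ENNReal.ofReal_le_ofReal_iff (by positivity)).1 hle
  -- The shift is `2 * r` because the sum over all supports has mean at most `exp (2 * r)`. The
  -- maximum over supports is replaced by the sum, a legitimate step as all terms are positive.
  let ψ : (Fin n → Bool) → (Fin n → Vec p) → ℝ := fun ξ x =>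
    c / 2 + B ^ 2 / (2 * c * lam) * (2 * r - 1 + Real.exp (-(2 * r)) * ∑ T ∈ 𝒯, e ξ T x)
  have hψi : ∀ ξ, Integrable (ψ ξ) Q := fun ξ =>
    (integrable_const _).add (((integrable_const _).add
      ((integrable_finsetSum _ fun T _ => (he ξ T).1).const_mul _)).const_mul _)
  have hψ : ∀ ξ, ∫ x, ψ ξ x ∂Q ≤ c := by
    intro ξ
    have hsum : ∫ x, ∑ T ∈ 𝒯, e ξ T x ∂Q ≤ Real.exp (2 * r) := by
      rw [integral_finsetSum _ fun T _ => (he ξ T).1]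
      calc ∑ T ∈ 𝒯, ∫ x, e ξ T x ∂Q ≤ ∑ T ∈ 𝒯, (2 : ℝ) ^ s :=
            Finset.sum_le_sum fun T hT => (he ξ T).2.trans
              (by rw [(Finset.mem_powersetCard.1 hT).2])
        _ = (p.choose s : ℝ) * 2 ^ s := by simp [𝒯]
        _ ≤ _ := choose_mul_two_pow_le hs hsp
    have hI : Integrable (fun x => ∑ T ∈ 𝒯, e ξ T x) Q :=
      integrable_finsetSum _ fun T _ => (he ξ T).1
    have h1 : ∫ x, ψ ξ x ∂Q = c / 2 + B ^ 2 / (2 * c * lam) *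
        (2 * r - 1 + Real.exp (-(2 * r)) * ∫ x, ∑ T ∈ 𝒯, e ξ T x ∂Q) := by
      have hI' : Integrable (fun x => 2 * r - 1 + Real.exp (-(2 * r)) * ∑ T ∈ 𝒯, e ξ T x) Q :=
        (integrable_const _).add (hI.const_mul _)
      simp only [ψ]
      rw [integral_const_add_mul hI', integral_const_add_mul hI]
    have h2 : Real.exp (-(2 * r)) * ∫ x, ∑ T ∈ 𝒯, e ξ T x ∂Q ≤ 1 := by
      calc _ ≤ Real.exp (-(2 * r)) * Real.exp (2 * r) :=
            mul_le_mul_of_nonneg_left hsum (Real.exp_pos _).le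
        _ = 1 := by rw [← Real.exp_add]; simp
    rw [h1]
    calc c / 2 + B ^ 2 / (2 * c * lam) *
        (2 * r - 1 + Real.exp (-(2 * r)) * ∫ x, ∑ T ∈ 𝒯, e ξ T x ∂Q)
        ≤ c / 2 + B ^ 2 / (2 * c * lam) * (2 * r) := by
          refine add_le_add le_rfl (mul_le_mul_of_nonneg_left (by linarith) (by positivity))
      _ = c / 2 + c ^ 2 / (2 * c) := by
          rw [hc2, hlam]
          field_simp
          ring
      _ = c := by field_simp; norm_num
  have hpt : ∀ ξ x, ⨆ w : sparseBall p B s, |∑ i, sgn (ξ i) * inner ℝ w.1 (x i)| ≤ ψ ξ x := by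
    intro ξ x
    have : Nonempty (sparseBall p B s) := ⟨⟨0, by simpa using hB.le, by simp⟩⟩
    refine ciSup_le fun w => ?_
    obtain ⟨T, hT, hwT⟩ := exists_support_superset w.2.2 hsp
    have h1 : ∑ i, sgn (ξ i) * inner ℝ w.1 (x i) = inner ℝ w.1 (∑ i, sgn (ξ i) • x i) := by
      simp only [inner_sum, inner_smul_right]
    rw [h1]
    refine (abs_inner_le_of_support hwT).trans ((mul_le_mul_of_nonneg_right w.2.1
      (Real.sqrt_nonneg _)).trans ?_)
    refine linear_le_of_exp hB hc0 hlam0 (Finset.sum_nonneg fun i _ => sq_nonneg _) ?_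
    exact Finset.single_le_sum (f := fun T => e ξ T x) (fun T _ => (Real.exp_pos _).le) hT
  refine ⟨fun x => (2 ^ n : ℝ)⁻¹ * ∑ ξ, ψ ξ x, (integrable_finsetSum _ fun ξ _ =>
    hψi ξ).const_mul _, fun x => mul_le_mul_of_nonneg_left (Finset.sum_le_sum fun ξ _ => hpt ξ x)
    (by positivity), ?_⟩
  rw [integral_const_mul, integral_finsetSum _ fun ξ _ => hψi ξ, inv_mul_le_iff₀ (by positivity)]
  calc ∑ ξ, ∫ x, ψ ξ x ∂Q ≤ ∑ _ξ : Fin n → Bool, c := Finset.sum_le_sum fun ξ _ => hψ ξ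
    _ = 2 ^ n * c := by simp

/-- Mean Rademacher average of the sparse network class over a Gaussian sample. -/
theorem integral_rad_sparseNet_le {S : Matrix (Fin p) (Fin p) ℝ} (hS : S.PosSemidef) {M : ℝ}
    (hM : 0 < M) (hSM : ∀ w, quad S w ≤ M * ‖w‖ ^ 2) (hn : 0 < n) {B : ℝ} (hB : 0 < B) {s : ℕ}
    (hs : 1 ≤ s) (hsp : s ≤ p) (L : ℕ) {d : ℕ → ℕ} (hd : ∀ l, 0 < d l) :
    ∫ x, rad (sparseNet p B L s d) x ∂(Measure.pi fun _ : Fin n => multivariateGaussian 0 S) ≤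
      2 ^ L * ((1 + 4 * (∫ t, ‖sigmoidHat t‖) * (B * Real.sqrt (8 * M))) *
        Real.sqrt (n * (s + s * Real.log (p / s)))) := by
  obtain ⟨Ψ, hΨi, hle, hΨ⟩ := exists_majorant_radAvg_linear hS hM hSM hn hB hs hsp
  have hs' : (1 : ℝ) ≤ s := by exact_mod_cast hs
  have hp' : (s : ℝ) ≤ p := by exact_mod_cast hsp
  have hlog : 0 ≤ Real.log ((p : ℝ) / s) :=
    Real.log_nonneg ((one_le_div (by linarith)).2 hp')
  set r : ℝ := s + s * Real.log (p / s) with hr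
  have hr1 : 1 ≤ r := by
    have : 0 ≤ s * Real.log ((p : ℝ) / s) := by positivity
    linarith
  have hK : 0 ≤ ∫ t, ‖sigmoidHat t‖ := integral_nonneg fun _ => norm_nonneg _
  have h1 : ∫ x, rad (sparseNet p B L s d) x
      ∂(Measure.pi fun _ : Fin n => multivariateGaussian 0 S) ≤
      ∫ x, 2 ^ L * (Real.sqrt n + 4 * (∫ t, ‖sigmoidHat t‖) * Ψ x)
      ∂(Measure.pi fun _ : Fin n => multivariateGaussian 0 S) := by
    refine integral_mono (sparseNet_regular hB.le L s d).integrable_rad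
      (((integrable_const _).add (hΨi.const_mul _)).const_mul _) fun x => ?_
    refine (rad_sparseNet_le hB.le L s hd x).trans (mul_le_mul_of_nonneg_left ?_ (by positivity))
    refine (rad_firstLayer_le hB.le s x).trans (add_le_add le_rfl ?_)
    exact mul_le_mul_of_nonneg_left (hle x) (by positivity)
  refine h1.trans ?_
  rw [integral_const_mul, integral_const_add_mul hΨi]
  refine mul_le_mul_of_nonneg_left ?_ (by positivity)
  have h2 : Real.sqrt n ≤ Real.sqrt (n * r) :=
    Real.sqrt_le_sqrt (le_mul_of_one_le_right (by positivity) hr1)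
  have h3 : Real.sqrt (8 * n * M * r) = Real.sqrt (8 * M) * Real.sqrt (n * r) := by
    rw [← Real.sqrt_mul (by positivity)]
    ring_nf
  rw [h3] at hΨ
  have h4 := mul_le_mul_of_nonneg_left hΨ (by positivity : 0 ≤ 4 * (∫ t, ‖sigmoidHat t‖))
  linarith

end SparseLinear

/-! ### Sparse directions realizing the spectral norm. -/

section Identification

variable {p : ℕ}

lemma quad_eq_inner (S : Matrix (Fin p) (Fin p) ℝ) (w : Vec p) :
    quad S w = inner ℝ w (Matrix.toEuclideanCLM (n := Fin p) (𝕜 := ℝ) S w) := by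
  rw [quad, Matrix.inner_toEuclideanCLM]

lemma quad_le_specNorm_mul (S : Matrix (Fin p) (Fin p) ℝ) (w : Vec p) :
    quad S w ≤ specNorm S * ‖w‖ ^ 2 := by
  rw [quad_eq_inner]
  calc _ ≤ ‖w‖ * ‖Matrix.toEuclideanCLM (n := Fin p) (𝕜 := ℝ) S w‖ := real_inner_le_norm _ _
    _ ≤ ‖w‖ * (specNorm S * ‖w‖) :=
        mul_le_mul_of_nonneg_left (ContinuousLinearMap.le_opNorm _ _) (norm_nonneg _)
    _ = _ := by ring

lemma quad_sub (S T : Matrix (Fin p) (Fin p) ℝ) (w : Vec p) :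
    quad (S - T) w = quad S w - quad T w := by
  simp [quad, Matrix.sub_mulVec, dotProduct_sub]

lemma quad_smul (S : Matrix (Fin p) (Fin p) ℝ) (c : ℝ) (w : Vec p) :
    quad S (c • w) = c ^ 2 * quad S w := by
  simp [quad, Matrix.mulVec_smul, sq, mul_assoc]

/-- A symmetric matrix has an eigenvector whose eigenvalue dominates its spectral norm. -/
lemma exists_eigenvector_specNorm_le [Nonempty (Fin p)] {A : Matrix (Fin p) (Fin p) ℝ}
    (hA : A.IsHermitian) :
    ∃ (u : Vec p) (lam : ℝ), ‖u‖ = 1 ∧ A.mulVec u.ofLp = lam • u.ofLp ∧ specNorm A ≤ |lam| := by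
  obtain ⟨i, -, hi⟩ := Finset.exists_max_image Finset.univ (fun i => |hA.eigenvalues i|)
    Finset.univ_nonempty
  refine ⟨hA.eigenvectorBasis i, hA.eigenvalues i, hA.eigenvectorBasis.norm_eq_one i,
    hA.mulVec_eigenvectorBasis i, ?_⟩
  refine ContinuousLinearMap.opNorm_le_bound _ (abs_nonneg _) fun x => ?_
  have hsa : ∀ j, inner ℝ (hA.eigenvectorBasis j) (Matrix.toEuclideanCLM (n := Fin p) (𝕜 := ℝ) A x) =
      hA.eigenvalues j * inner ℝ (hA.eigenvectorBasis j) x := by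
    intro j
    rw [Matrix.inner_toEuclideanCLM]
    have h1 := hA.mulVec_eigenvectorBasis j
    have h2 : Matrix.transpose A = A := by simpa using hA.eq
    simp only
    rw [Matrix.dotProduct_mulVec, ← Matrix.mulVec_transpose, h2, h1, smul_dotProduct,
      smul_eq_mul, EuclideanSpace.inner_eq_star_dotProduct, dotProduct_comm]
    simp
  refine le_of_sq_le_sq ?_ (by positivity)
  rw [mul_pow, ← hA.eigenvectorBasis.sum_sq_norm_inner_right,
    ← hA.eigenvectorBasis.sum_sq_norm_inner_right x, Finset.mul_sum]
  refine Finset.sum_le_sum fun j _ => ?_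
  rw [hsa, norm_mul, mul_pow]
  refine mul_le_mul_of_nonneg_right ?_ (sq_nonneg _)
  exact pow_le_pow_left₀ (norm_nonneg _) (hi j (Finset.mem_univ _)) 2

/-- The spectral norm of a difference of sparse covariance matrices is attained along a sparse
direction. -/
theorem exists_sparse_direction {k : ℕ} (hk : 1 ≤ k) (hp : 0 < p)
    {S T : Matrix (Fin p) (Fin p) ℝ} (hS : S ∈ sparseCov p k) (hT : T ∈ sparseCov p k) :
    ∃ w : Vec p, ‖w‖ = 1 ∧ {i | w i ≠ 0}.ncard ≤ 2 * k ∧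
      specNorm (S - T) ≤ |quad S w - quad T w| := by
  have : Nonempty (Fin p) := ⟨⟨0, hp⟩⟩
  obtain ⟨hS1, I₁, hI₁, hS2⟩ := hS
  obtain ⟨hT1, I₂, hI₂, hT2⟩ := hT
  have hoff : ∀ i j, i ≠ j → (i ∉ I₁ ∪ I₂ ∨ j ∉ I₁ ∪ I₂) → (S - T) i j = 0 := by
    intro i j hij h
    have h1 := hS2 i j (by simp only [Finset.mem_union, not_or] at h; tauto)
    have h2 := hT2 i j (by simp only [Finset.mem_union, not_or] at h; tauto)
    rw [Matrix.sub_apply, Matrix.diagonal_apply_ne _ hij, sub_zero] at h1 h2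
    rw [Matrix.sub_apply, h1, h2, sub_zero]
  obtain ⟨u, lam, hu1, hu, hlam⟩ := exists_eigenvector_specNorm_le (hS1.1.sub hT1.1)
  -- Off the union of the two blocks `S - T` is diagonal. If the eigenvector charges such a
  -- coordinate `i`, the `i`-th eigenvalue equation shows that the diagonal entry is the eigenvalue,
  -- and the basis vector does the job. Otherwise the eigenvector is itself supported on at most
  -- `2k` coordinates.
  by_cases hex : ∃ i, i ∉ I₁ ∪ I₂ ∧ u i ≠ 0
  · obtain ⟨i, hi, hui⟩ := hex
    have h1 := congrFun hu i
    rw [Matrix.mulVec, dotProduct, Finset.sum_eq_single i (fun j _ hj => by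
      rw [hoff i j hj.symm (Or.inl hi), zero_mul]) (by simp), Pi.smul_apply, smul_eq_mul] at h1
    have h2 : (S - T) i i = lam := mul_right_cancel₀ hui h1
    refine ⟨EuclideanSpace.single i 1, by simp, ?_, ?_⟩
    · refine (Set.ncard_le_ncard (t := {i}) (fun j hj => ?_)).trans (by simp; omega)
      by_contra hne
      exact hj (by simp [Set.mem_singleton_iff.not.1 hne])
    · rw [← quad_sub]
      have h3 : quad (S - T) (EuclideanSpace.single i 1) = (S - T) i i := by
        simp [quad]
      rwa [h3, h2]
  · push Not at hex
    refine ⟨u, hu1, ?_, ?_⟩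
    · refine (Set.ncard_le_ncard (t := ((I₁ ∪ I₂ : Finset (Fin p)) : Set (Fin p)))
        fun j hj => ?_).trans ?_
      · by_contra hne
        exact hj (hex j hne)
      · rw [Set.ncard_coe_finset]
        exact (Finset.card_union_le _ _).trans (by omega)
    · rw [← quad_sub, quad, hu, dotProduct_smul, smul_eq_mul]
      have h3 : u.ofLp ⬝ᵥ u.ofLp = ‖u‖ ^ 2 := by
        rw [EuclideanSpace.real_norm_sq_eq, dotProduct]
        exact Finset.sum_congr rfl fun i _ => (sq _).symm
      rwa [h3, hu1, one_pow, mul_one]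

end Identification

/-! ### Dependence of the mean of a sigmoid node on the variance. -/

section GaussianSigmoid

/-- The denominator in the even part of the shifted sigmoid function. -/
def sigDen (y : ℝ) : ℝ := Real.exp 1 ^ 2 + 1 + 2 * Real.exp 1 * Real.cosh y

lemma sigDen_pos (y : ℝ) : 0 < sigDen y := by
  have := Real.cosh_pos y
  unfold sigDen
  positivity

lemma one_le_sigDen (y : ℝ) : 1 ≤ sigDen y := by
  have := Real.cosh_pos y
  have h : 0 ≤ Real.exp 1 ^ 2 + 2 * Real.exp 1 * Real.cosh y := by positivity
  unfold sigDen
  linarith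

lemma sigDen_le {a b : ℝ} (h : |a| ≤ |b|) : sigDen a ≤ sigDen b := by
  have := Real.cosh_le_cosh.2 h
  unfold sigDen
  gcongr

/-- A symmetric law sees only the even part of the node. Without a bias that part is constant, as
`σ(y) + σ(-y) = 1`; the bias 1 makes it strictly decreasing in `|y|`. -/
lemma sigmoid_add_sigmoid (y : ℝ) :
    Real.sigmoid (y + 1) + Real.sigmoid (-y + 1) = 1 + (Real.exp 1 ^ 2 - 1) / sigDen y := by
  have h1 : Real.exp (-y) = (Real.exp y)⁻¹ := Real.exp_neg y
  have h2 : Real.exp (-1) = (Real.exp 1)⁻¹ := Real.exp_neg 1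
  have h3 := Real.exp_pos y
  have h4 := Real.exp_pos 1
  have hd : sigDen y = Real.exp 1 ^ 2 + 1 + Real.exp 1 * (Real.exp y + (Real.exp y)⁻¹) := by
    rw [sigDen, Real.cosh_eq, h1]; ring
  rw [Real.sigmoid_def, Real.sigmoid_def, hd, neg_add, neg_add, neg_neg, Real.exp_add,
    Real.exp_add, h1, h2]
  have h5 : 0 < Real.exp 1 ^ 2 + 1 + Real.exp 1 * (Real.exp y + (Real.exp y)⁻¹) := by positivity
  field_simp
  ring

/-- Over the common denominator, the numerator is a difference of hyperbolic cosines and grows at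
least like `(a₂ ^ 2 - a₁ ^ 2) * z ^ 2`, while both factors of the denominator are at most `sigDen (V
* z)`. -/
lemma inv_sigDen_sub_ge {a₁ a₂ V z : ℝ} (h1 : 0 ≤ a₁) (h12 : a₁ ≤ a₂) (h2 : a₂ ≤ V) :
    Real.exp 1 * (a₂ ^ 2 - a₁ ^ 2) * (z ^ 2 / sigDen (V * z) ^ 2) ≤
      1 / sigDen (a₁ * z) - 1 / sigDen (a₂ * z) := by
  have hV : ∀ a, 0 ≤ a → a ≤ V → sigDen (a * z) ≤ sigDen (V * z) := fun a ha haV => by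
    refine sigDen_le ?_
    rw [abs_mul, abs_mul, abs_of_nonneg ha, abs_of_nonneg (ha.trans haV)]
    exact mul_le_mul_of_nonneg_right haV (abs_nonneg _)
  have d1 := sigDen_pos (a₁ * z)
  have d2 := sigDen_pos (a₂ * z)
  have d := sigDen_pos (V * z)
  have hc := sq_sub_sq_le_cosh_sub_cosh (a := a₂ * |z|) (b := a₁ * |z|)
    (mul_nonneg h1 (abs_nonneg _)) (mul_le_mul_of_nonneg_right h12 (abs_nonneg _))
  have habs : ∀ a, 0 ≤ a → Real.cosh (a * |z|) = Real.cosh (a * z) := fun a ha => by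
    rw [← Real.cosh_abs (a * z), abs_mul, abs_of_nonneg ha]
  rw [habs _ h1, habs _ (h1.trans h12), mul_pow, mul_pow, sq_abs] at hc
  have hnum : Real.exp 1 * (a₂ ^ 2 - a₁ ^ 2) * z ^ 2 ≤ sigDen (a₂ * z) - sigDen (a₁ * z) := by
    have := mul_le_mul_of_nonneg_left hc (by positivity : 0 ≤ 2 * Real.exp 1)
    unfold sigDen
    linarith
  have hnn : 0 ≤ sigDen (a₂ * z) - sigDen (a₁ * z) := by
    refine le_trans ?_ hnum
    have : 0 ≤ a₂ ^ 2 - a₁ ^ 2 := by nlinarith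
    positivity
  rw [div_sub_div _ _ d1.ne' d2.ne', one_mul, mul_one, ← mul_div_assoc]
  refine div_le_div₀ hnn hnum (mul_pos d1 d2) ?_
  rw [sq]
  exact mul_le_mul (hV _ h1 (h12.trans h2)) (hV _ (h1.trans h12) h2) d2.le d.le

/-- The weight that quantifies how the mean of a sigmoid node depends on the variance. -/
def sigWeight (V : ℝ) : ℝ := ∫ z, z ^ 2 / sigDen (V * z) ^ 2 ∂(gaussianReal 0 1)

lemma continuous_sigDen : Continuous sigDen := by
  unfold sigDen
  fun_prop

lemma integrable_sigWeight (V : ℝ) :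
    Integrable (fun z => z ^ 2 / sigDen (V * z) ^ 2) (gaussianReal 0 1) := by
  have h : Integrable (fun z : ℝ => z ^ 2) (gaussianReal 0 1) :=
    (memLp_id_gaussianReal (μ := 0) (v := 1) 2).integrable_sq
  refine h.mono' (Continuous.aestronglyMeasurable ?_) (Filter.Eventually.of_forall fun z => ?_)
  · exact (continuous_id.pow 2).div ((continuous_sigDen.comp (by fun_prop)).pow 2)
      fun z => (pow_pos (sigDen_pos _) 2).ne'
  · rw [Real.norm_eq_abs, abs_of_nonneg (by positivity)]
    exact div_le_self (sq_nonneg z) (one_le_pow₀ (one_le_sigDen _))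

lemma sigWeight_pos (V : ℝ) : 0 < sigWeight V := by
  rw [sigWeight, integral_pos_iff_support_of_nonneg (fun z => by positivity)
    (integrable_sigWeight V)]
  have hs : Function.support (fun z => z ^ 2 / sigDen (V * z) ^ 2) = {0}ᶜ := by
    ext z
    have := (sigDen_pos (V * z)).ne'
    simp [this]
  rw [hs]
  have := nullSingletonClass_gaussianReal (μ := 0) (v := 1) one_ne_zero
  rw [prob_compl_eq_one_sub (measurableSet_singleton _), measure_singleton]
  simp

/-- The mean of `σ(a Z + 1)` for a standard Gaussian `Z`. -/
def sigMean (a : ℝ) : ℝ := ∫ z, Real.sigmoid (a * z + 1) ∂(gaussianReal 0 1)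

lemma integrable_sigmoid_comp {h : ℝ → ℝ} (hh : Continuous h) {μ : Measure ℝ} [IsFiniteMeasure μ] :
    Integrable (fun z => Real.sigmoid (h z)) μ :=
  integrable_of_bdd (continuous_sigmoid.comp hh).measurable ⟨1, fun z => by
    rw [abs_of_pos (Real.sigmoid_pos _)]; exact Real.sigmoid_le_one _⟩

lemma integrable_inv_sigDen (a : ℝ) :
    Integrable (fun z => 1 / sigDen (a * z)) (gaussianReal 0 1) := by
  refine integrable_of_bdd (Continuous.measurable ?_) ⟨1, fun z => ?_⟩
  · exact continuous_const.div (continuous_sigDen.comp (by fun_prop)) fun z => (sigDen_pos _).ne'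
  · rw [abs_of_pos (div_pos one_pos (sigDen_pos _))]
    exact (div_le_one (sigDen_pos _)).2 (one_le_sigDen _)

lemma sigMean_eq (a : ℝ) :
    sigMean a = 1 / 2 + (Real.exp 1 ^ 2 - 1) / 2 * ∫ z, 1 / sigDen (a * z) ∂(gaussianReal 0 1) := by
  have h1 : sigMean a = ∫ z, Real.sigmoid (-(a * z) + 1) ∂(gaussianReal 0 1) := by
    have hm := gaussianReal_map_neg (μ := 0) (v := 1)
    rw [neg_zero] at hm
    rw [sigMean]
    conv_lhs => rw [← hm]
    have hc : Continuous fun z => Real.sigmoid (a * z + 1) := continuous_sigmoid.comp (by fun_prop)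
    rw [integral_map (by fun_prop) hc.aestronglyMeasurable]
    simp only [mul_neg]
  have h2 : sigMean a + sigMean a =
      ∫ z, (1 + (Real.exp 1 ^ 2 - 1) * (1 / sigDen (a * z))) ∂(gaussianReal 0 1) := by
    conv_lhs => rw [h1]
    conv_lhs => arg 1; rw [← h1, sigMean]
    rw [← integral_add (integrable_sigmoid_comp (by fun_prop))
      (integrable_sigmoid_comp (by fun_prop))]
    refine integral_congr_ae (Filter.Eventually.of_forall fun z => ?_)
    simp only [sigmoid_add_sigmoid]
    ring
  rw [integral_const_add_mul (integrable_inv_sigDen a)] at h2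
  linarith

lemma sigMean_sub_ge {a₁ a₂ V : ℝ} (h1 : 0 ≤ a₁) (h12 : a₁ ≤ a₂) (h2 : a₂ ≤ V) :
    (Real.exp 1 ^ 2 - 1) / 2 * (Real.exp 1 * sigWeight V) * (a₂ ^ 2 - a₁ ^ 2) ≤
      sigMean a₁ - sigMean a₂ := by
  have he : 1 ≤ Real.exp 1 := by linarith [Real.add_one_le_exp 1]
  have he2 : 0 ≤ (Real.exp 1 ^ 2 - 1) / 2 := by nlinarith
  have h : Real.exp 1 * (a₂ ^ 2 - a₁ ^ 2) * sigWeight V ≤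
      (∫ z, 1 / sigDen (a₁ * z) ∂(gaussianReal 0 1)) -
        ∫ z, 1 / sigDen (a₂ * z) ∂(gaussianReal 0 1) := by
    rw [sigWeight, ← integral_const_mul,
      ← integral_sub (integrable_inv_sigDen _) (integrable_inv_sigDen _)]
    exact integral_mono ((integrable_sigWeight V).const_mul _)
      ((integrable_inv_sigDen _).sub (integrable_inv_sigDen _))
      fun z => inv_sigDen_sub_ge h1 h12 h2
  have := mul_le_mul_of_nonneg_left h he2
  rw [sigMean_eq, sigMean_eq]
  linarith

variable {p : ℕ}

lemma integral_sigmoid_eq_sigMean {S : Matrix (Fin p) (Fin p) ℝ} (hS : S.PosSemidef) (w : Vec p) :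
    ∫ y : Vec p, Real.sigmoid (inner ℝ w y + 1) ∂(multivariateGaussian 0 S) =
      sigMean (Real.sqrt (quad S w)) := by
  have h1 := map_inner_multivariateGaussian hS w
  have h2 := gaussianReal_map_const_mul (μ := 0) (v := 1) (Real.sqrt (quad S w))
  have h3 : NNReal.mk (Real.sqrt (quad S w) ^ 2) (sq_nonneg _) * 1 = (quad S w).toNNReal := by
    ext
    simp [Real.sq_sqrt (quad_nonneg hS w), quad_nonneg hS w]
  rw [h3, mul_zero] at h2
  have hc : Continuous fun u => Real.sigmoid (u + 1) := continuous_sigmoid.comp (by fun_prop)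
  have h4 : ∫ u, Real.sigmoid (u + 1) ∂(gaussianReal 0 (quad S w).toNNReal) =
      ∫ y : Vec p, Real.sigmoid (inner ℝ w y + 1) ∂(multivariateGaussian 0 S) := by
    rw [← h1, integral_map (Continuous.aemeasurable (by fun_prop)) hc.aestronglyMeasurable]
  rw [← h4, ← h2, integral_map (Continuous.aemeasurable (by fun_prop)) hc.aestronglyMeasurable]
  rfl

/-- Sigmoid nodes separate centered Gaussian measures at a linear rate in the variance. -/
theorem sigmoid_separation {S T : Matrix (Fin p) (Fin p) ℝ} (hS : S.PosSemidef)
    (hT : T.PosSemidef) {w : Vec p} {V : ℝ} (hSV : quad S w ≤ V) (hTV : quad T w ≤ V) :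
    (Real.exp 1 ^ 2 - 1) / 2 * (Real.exp 1 * sigWeight (Real.sqrt V)) * |quad S w - quad T w| ≤
      |∫ y : Vec p, Real.sigmoid (inner ℝ w y + 1) ∂(multivariateGaussian 0 S) -
        ∫ y : Vec p, Real.sigmoid (inner ℝ w y + 1) ∂(multivariateGaussian 0 T)| := by
  rw [integral_sigmoid_eq_sigMean hS, integral_sigmoid_eq_sigMean hT]
  have key : ∀ {a b : ℝ}, 0 ≤ a → a ≤ b → b ≤ V →
      (Real.exp 1 ^ 2 - 1) / 2 * (Real.exp 1 * sigWeight (Real.sqrt V)) * |a - b| ≤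
        |sigMean (Real.sqrt a) - sigMean (Real.sqrt b)| := by
    intro a b ha hab hb
    have h := sigMean_sub_ge (Real.sqrt_nonneg a) (Real.sqrt_le_sqrt hab) (Real.sqrt_le_sqrt hb)
    rw [Real.sq_sqrt ha, Real.sq_sqrt (ha.trans hab)] at h
    rw [abs_of_nonpos (by linarith : a - b ≤ 0), neg_sub]
    exact h.trans (le_abs_self _)
  rcases le_total (quad S w) (quad T w) with h | h
  · exact key (quad_nonneg hS w) h hTV
  · rw [abs_sub_comm, abs_sub_comm (sigMean _)]
    exact key (quad_nonneg hT w) h hSV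

end GaussianSigmoid

/-! ### From the deviation to the spectral error. -/

section Estimator

variable {p n : ℕ} {B : ℝ} {D : Set (Vec p → ℝ)}

/-- Deterministic bound for the discrepancy between the estimate and the target. -/
theorem IsWGANEstimate.integral_sub_le {Θ : Set (Matrix (Fin p) (Fin p) ℝ)} (hD : Regular B D)
    {x : Fin n → Vec p} {Shat Sstar : Matrix (Fin p) (Fin p) ℝ}
    (h : IsWGANEstimate D Θ x Shat) (hs : Sstar ∈ Θ) {f : Vec p → ℝ} (hf : f ∈ D) :
    ∫ y, f y ∂(multivariateGaussian 0 Sstar) - ∫ y, f y ∂(multivariateGaussian 0 Shat) ≤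
      2 * dev D (multivariateGaussian 0 Sstar) x := by
  set d := dev D (multivariateGaussian 0 Sstar) x with hd
  have hterm : ∀ f ∈ D, |(n : ℝ)⁻¹ * ∑ i, f (x i) - ∫ y, f y ∂(multivariateGaussian 0 Sstar)| ≤ d :=
    fun f hf => (hD.bdd_dev_term (ν := multivariateGaussian 0 Sstar) x).le_ciSup ⟨f, hf⟩
  -- The objective at the estimate is at most the objective at the truth, hence at most `d`; passing
  -- from the true mean of `f` to its empirical mean costs another `d`.
  have h1 : ganObjective D x Sstar ≤ d := by
    refine Real.sSup_le ?_ (dev_nonneg _ _ _)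
    rintro _ ⟨f, hf, rfl⟩
    exact (le_abs_self _).trans (hterm f hf)
  have h2 : (n : ℝ)⁻¹ * ∑ i, f (x i) - ∫ y, f y ∂(multivariateGaussian 0 Shat) ≤
      ganObjective D x Shat := by
    refine le_csSup ⟨2, ?_⟩ ⟨f, hf, rfl⟩
    rintro _ ⟨g, hg, rfl⟩
    exact (le_abs_self _).trans (hD.abs_dev_term_le (ν := multivariateGaussian 0 Shat) x ⟨g, hg⟩)
  have h3 := (abs_le.1 (hterm f hf)).1
  have h4 := h.2 _ hs
  linarith

/-- The constant relating variances to means of sigmoid nodes on the parameter space. -/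
def sepConst (M₁ M₂ : ℝ) : ℝ :=
  (Real.exp 1 ^ 2 - 1) / 2 * (Real.exp 1 * sigWeight (Real.sqrt (M₂ * (1 / M₁) ^ 2)))

lemma sepConst_pos (M₁ M₂ : ℝ) : 0 < sepConst M₁ M₂ := by
  have h := sigWeight_pos (Real.sqrt (M₂ * (1 / M₁) ^ 2))
  have he : 2 ≤ Real.exp 1 := by linarith [Real.add_one_le_exp 1]
  have h2 : 0 < (Real.exp 1 ^ 2 - 1) / 2 := by nlinarith
  unfold sepConst
  positivity

/-- The spectral error of the estimator is controlled by the deviation over the network class. -/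
theorem IsWGANEstimate.specNorm_le {M₁ M₂ : ℝ} (hM₁ : 0 < M₁) {k : ℕ} (hk : 1 ≤ k) (hp : 0 < p)
    (hD : Regular B D) (hsub : firstLayer p (1 / M₁) (2 * k) ⊆ D) {x : Fin n → Vec p}
    {Shat Sstar : Matrix (Fin p) (Fin p) ℝ}
    (h : IsWGANEstimate D (paramSpace p k M₁ M₂) x Shat) (hs : Sstar ∈ paramSpace p k M₁ M₂) :
    specNorm (Shat - Sstar) ≤ 2 * M₁ ^ 2 / sepConst M₁ M₂ *
      dev D (multivariateGaussian 0 Sstar) x := by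
  have hc := sepConst_pos M₁ M₂
  obtain ⟨u, hu, hsparse, hnorm⟩ := exists_sparse_direction hk hp h.1.1 hs.1
  -- The sparse unit direction is stretched to the full radius allowed for first-layer weights.
  set w : Vec p := (1 / M₁) • u with hw
  have hwn : ‖w‖ = 1 / M₁ := by
    rw [hw, norm_smul, hu, mul_one, Real.norm_eq_abs, abs_of_pos (by positivity)]
  have hws : {i | w i ≠ 0}.ncard ≤ 2 * k := by
    refine (Set.ncard_le_ncard fun i hi => ?_).trans hsparse
    intro h0
    exact hi (by simp [hw, h0])
  have hq : ∀ S ∈ paramSpace p k M₁ M₂, quad S w ≤ M₂ * (1 / M₁) ^ 2 := fun S hS => by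
    refine (quad_le_specNorm_mul S w).trans ?_
    rw [hwn]
    exact mul_le_mul_of_nonneg_right hS.2.2 (sq_nonneg _)
  have hsep := sigmoid_separation h.1.1.1 hs.1.1 (hq _ h.1) (hq _ hs)
  change sepConst M₁ M₂ * _ ≤ _ at hsep
  set N₁ := multivariateGaussian (0 : Vec p) Shat with hN₁
  set N₂ := multivariateGaussian (0 : Vec p) Sstar with hN₂
  let f : Vec p → ℝ := fun y => Real.sigmoid (inner ℝ w y + 1)
  -- The objective is one-sided and a one-layer class is not closed under negation. The node with
  -- opposite weight and bias equals `1 - f` and supplies the reverse inequality.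
  let f' : Vec p → ℝ := fun y => Real.sigmoid (inner ℝ (-w) y + -1)
  have hf : f ∈ D := hsub ⟨w, 1, hwn.le, hws, rfl⟩
  have hf' : f' ∈ D := hsub ⟨-w, -1, by rw [norm_neg, hwn], by simpa using hws, rfl⟩
  have hff : ∀ y, f' y = 1 - f y := fun y => by
    simp only [f, f', inner_neg_left]
    rw [← neg_add, Real.sigmoid_neg]
  have h1 := h.integral_sub_le hD hs hf
  have h2 := h.integral_sub_le hD hs hf'
  simp only [hff] at h2
  rw [integral_sub (integrable_const _) (hD.integrable hf),
    integral_sub (integrable_const _) (hD.integrable hf)] at h2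
  simp only [integral_const, probReal_univ, one_smul] at h2
  have h3 : |∫ y, f y ∂N₁ - ∫ y, f y ∂N₂| ≤ 2 * dev D N₂ x := by
    rw [abs_le]
    constructor <;> linarith
  have h4 : |quad Shat w - quad Sstar w| = (1 / M₁) ^ 2 * |quad Shat u - quad Sstar u| := by
    rw [hw, quad_smul, quad_smul, ← mul_sub, abs_mul, abs_of_nonneg (sq_nonneg (1 / M₁))]
  have h5 : sepConst M₁ M₂ * ((1 / M₁) ^ 2 * specNorm (Shat - Sstar)) ≤ 2 * dev D N₂ x := by
    refine le_trans ?_ (hsep.trans h3)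
    rw [h4]
    gcongr
  rw [div_mul_eq_mul_div, le_div_iff₀ hc]
  have h6 := mul_le_mul_of_nonneg_left h5 (sq_nonneg M₁)
  have h7 : M₁ ^ 2 * (sepConst M₁ M₂ * ((1 / M₁) ^ 2 * specNorm (Shat - Sstar))) =
      specNorm (Shat - Sstar) * sepConst M₁ M₂ := by
    field_simp
  rw [h7] at h6
  linarith

/-- High-probability bound for the deviation over the network class under contamination. -/
theorem dev_sparseNet_tail {S : Matrix (Fin p) (Fin p) ℝ} (hS : S.PosSemidef) {M : ℝ} (hM : 0 < M)
    (hSM : ∀ w, quad S w ≤ M * ‖w‖ ^ 2) (hn : 0 < n) (hB : 0 < B) {s : ℕ} (hs : 1 ≤ s)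
    (hsp : s ≤ p) (L : ℕ) {d : ℕ → ℕ} (hd : ∀ l, 0 < d l) {P : Measure (Vec p)}
    [IsProbabilityMeasure P] {ε : ℝ} (hε : 0 ≤ ε)
    (hW : W1 P (multivariateGaussian 0 S) ≤ ENNReal.ofReal ε) {r : ℝ}
    (hr : r = s + s * Real.log (p / s)) :
    (Measure.pi fun _ : Fin n => P).real
      {x | (2 * (1 + 4 * (∫ t, ‖sigmoidHat t‖) * (B * Real.sqrt (8 * M))) + B + 6) *
        max (2 ^ L * Real.sqrt (r / n)) ε ≤
          dev (sparseNet p B L s d) (multivariateGaussian 0 S) x} ≤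
      Real.exp (-(r + n * ε ^ 2)) := by
  have hn' : (0 : ℝ) < n := by exact_mod_cast hn
  have hs' : (1 : ℝ) ≤ s := by exact_mod_cast hs
  have hp' : (s : ℝ) ≤ p := by exact_mod_cast hsp
  have hlog : 0 ≤ Real.log ((p : ℝ) / s) := Real.log_nonneg ((one_le_div (by linarith)).2 hp')
  have hr0 : 0 ≤ r := by rw [hr]; positivity
  have hF := sparseNet_regular (p := p) hB.le L s d
  have hK0 : 0 ≤ ∫ t, ‖sigmoidHat t‖ := integral_nonneg fun _ => norm_nonneg _
  set K := 1 + 4 * (∫ t, ‖sigmoidHat t‖) * (B * Real.sqrt (8 * M)) with hK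
  have hKpos : 0 ≤ K := by positivity
  set N := multivariateGaussian (0 : Vec p) S with hN
  set m := max (2 ^ L * Real.sqrt (r / n)) ε with hm
  have hm1 : 2 ^ L * Real.sqrt (r / n) ≤ m := le_max_left _ _
  have hm2 : ε ≤ m := le_max_right _ _
  have hm3 : Real.sqrt (r / n) ≤ m :=
    (le_mul_of_one_le_left (Real.sqrt_nonneg _) (one_le_pow₀ one_le_two)).trans hm1
  -- Chosen so that the concentration exponent `n * t ^ 2 / 8` equals `r + n * ε ^ 2`. In the final
  -- constant `2 * K` comes from symmetrization, `B` from contamination and 6 from `t ≤ 6 * m`.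
  set t := Real.sqrt (8 * (r / n + ε ^ 2)) with ht
  have ht2 : n * t ^ 2 / 8 = r + n * ε ^ 2 := by
    rw [ht, Real.sq_sqrt (by positivity)]
    field_simp
  have htm : t ≤ 6 * m := by
    have h1 : Real.sqrt (r / n) ^ 2 = r / n := Real.sq_sqrt (by positivity)
    refine Real.sqrt_le_iff.2 ⟨by linarith, ?_⟩
    have h2 := pow_le_pow_left₀ (Real.sqrt_nonneg _) hm3 2
    have h3 := pow_le_pow_left₀ hε hm2 2
    rw [h1] at h2
    nlinarith
  have hmean : ∫ x, dev (sparseNet p B L s d) N x ∂(Measure.pi fun _ : Fin n => P) ≤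
      (2 * K + B) * m := by
    have h1 := hF.integral_dev_le_of_W1 hB.le hn hε hW
    have h2 := hF.integral_dev_le hn N
    have h3 := integral_rad_sparseNet_le hS hM hSM hn hB hs hsp L hd
    rw [← hr, ← hK] at h3
    have h4 : Real.sqrt (n * r) = n * Real.sqrt (r / n) := by
      rw [show n * r = (n : ℝ) ^ 2 * (r / n) by field_simp, Real.sqrt_mul (sq_nonneg _),
        Real.sqrt_sq hn'.le]
    have h5 := mul_le_mul_of_nonneg_left h3 (by positivity : (0 : ℝ) ≤ 2 / n)
    rw [h4] at h5
    have h6 : 2 / (n : ℝ) * (2 ^ L * (K * (n * Real.sqrt (r / n)))) =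
        2 * K * (2 ^ L * Real.sqrt (r / n)) := by
      field_simp
    rw [h6] at h5
    have h7 := mul_le_mul_of_nonneg_left hm1 (by positivity : 0 ≤ 2 * K)
    have h8 := mul_le_mul_of_nonneg_left hm2 hB.le
    linarith
  have htail := hF.dev_concentration (ν := N) hn P (Real.sqrt_nonneg (8 * (r / n + ε ^ 2)))
  rw [← ht, ht2] at htail
  refine (measureReal_mono (fun x hx => ?_)).trans htail
  simp only [Set.mem_ofPred_eq] at hx ⊢
  linarith

end Estimator

end WGAN

end

/-! ### The main theorem. -/

theorem theorem12 (M₁ M₂ : ℝ) (hM₁ : 0 < M₁) (hM : M₁ ≤ M₂) :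
    ∃ c C : ℝ, 0 < c ∧ 0 < C ∧
      ∀ (p k n L : ℕ) (d : ℕ → ℕ) (ε : ℝ),
        1 ≤ k → 2 * k < p → 1 ≤ n → 1 ≤ L → (∀ l, 0 < d l) → 0 ≤ ε →
        2 ^ L * (WGAN.complexity p k / n) + ε ^ 2 ≤ c →
      ∀ Sstar ∈ WGAN.paramSpace p k M₁ M₂,
      ∀ P : Measure (WGAN.Vec p), IsProbabilityMeasure P →
        WGAN.W1 P (multivariateGaussian 0 Sstar) ≤ ENNReal.ofReal ε →
      ∀ (Ω : Type*) (mΩ : MeasurableSpace Ω) (μ : Measure Ω), IsProbabilityMeasure μ →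
      ∀ X : Fin n → Ω → WGAN.Vec p, (∀ i, HasLaw (X i) P μ) → iIndepFun X μ →
      ∀ Shat : Ω → Matrix (Fin p) (Fin p) ℝ,
        (∀ᵐ ω ∂μ, WGAN.IsWGANEstimate (WGAN.sparseNet p (1 / M₁) L (2 * k) d)
          (WGAN.paramSpace p k M₁ M₂) (fun i => X i ω) (Shat ω)) →
        μ {ω | ¬ WGAN.specNorm (Shat ω - Sstar) ≤
            C * max (2 ^ L * Real.sqrt (WGAN.complexity p k / n)) ε}
          ≤ ENNReal.ofReal (Real.exp (-(WGAN.complexity p k + n * ε ^ 2))) := by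
  have hM₂ : 0 < M₂ := hM₁.trans_le hM
  have hc := WGAN.sepConst_pos M₁ M₂
  have hB : 0 < 1 / M₁ := by positivity
  have hK0 : 0 ≤ ∫ t, ‖WGAN.sigmoidHat t‖ := integral_nonneg fun _ => norm_nonneg _
  set K := 2 * (1 + 4 * (∫ t, ‖WGAN.sigmoidHat t‖) * (1 / M₁ * Real.sqrt (8 * M₂))) + 1 / M₁ + 6
    with hK
  have hKpos : 0 < K := by positivity
  -- The constant is the product of the deterministic factor from `IsWGANEstimate.specNorm_le` and
  -- the stochastic factor from `dev_sparseNet_tail` with `B = 1 / M₁` and `M = M₂`.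
  refine ⟨1, 2 * M₁ ^ 2 / WGAN.sepConst M₁ M₂ * K, one_pos, by positivity, ?_⟩
  intro p k n L d ε hk hkp hn _ hd hε _ Sstar hS P hP hW Ω mΩ μ hμ X hX hindep Shat hShat
  have hS1 : Sstar.PosSemidef := hS.1.1
  have hSM : ∀ w, WGAN.quad Sstar w ≤ M₂ * ‖w‖ ^ 2 := fun w =>
    (WGAN.quad_le_specNorm_mul Sstar w).trans (mul_le_mul_of_nonneg_right hS.2.2 (sq_nonneg _))
  have htail := WGAN.dev_sparseNet_tail hS1 hM₂ hSM (show 0 < n by omega) hB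
    (show 1 ≤ 2 * k by omega) hkp.le L hd hε hW (r := WGAN.complexity p k) (by
      rw [WGAN.complexity]; push_cast; ring)
  rw [← hK] at htail
  set m := max (2 ^ L * Real.sqrt (WGAN.complexity p k / n)) ε with hm
  set F := WGAN.sparseNet p (1 / M₁) L (2 * k) d with hFdef
  have hF : WGAN.Regular (1 / M₁) F := WGAN.sparseNet_regular hB.le L (2 * k) d
  have hXm : ∀ i, AEMeasurable (X i) μ := fun i => (hX i).aemeasurable
  have hlaw : μ.map (fun ω i => X i ω) = Measure.pi fun _ : Fin n => P := by
    rw [(iIndepFun_iff_map_fun_eq_pi_map hXm).1 hindep]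
    simp only [(hX _).map_eq]
  set A : Set (Fin n → WGAN.Vec p) :=
    {x | K * m ≤ WGAN.dev F (multivariateGaussian 0 Sstar) x} with hA
  have hAm : MeasurableSet A := measurableSet_le measurable_const hF.measurable_dev
  calc μ {ω | ¬ WGAN.specNorm (Shat ω - Sstar) ≤ 2 * M₁ ^ 2 / WGAN.sepConst M₁ M₂ * K * m}
      ≤ μ ((fun ω i => X i ω) ⁻¹' A) := by
        -- The failure event need not be measurable, as `Shat` is arbitrary; it is contained, up to
        -- a null set, in the preimage of the measurable set `A`.
        refine measure_mono_ae ?_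
        filter_upwards [hShat] with ω hω hbad
        by_contra hgood
        refine hbad ((hω.specNorm_le hM₁ hk (by omega) hF
          (WGAN.firstLayer_subset_sparseNet hd) hS).trans ?_)
        rw [mul_assoc]
        exact mul_le_mul_of_nonneg_left (not_le.1 hgood).le (by positivity)
    _ = (Measure.pi fun _ : Fin n => P) A := by
        rw [← hlaw, Measure.map_apply_of_aemeasurable (aemeasurable_pi_lambda _ hXm) hAm]
    _ ≤ _ := by
        rw [← ofReal_measureReal]
        exact ENNReal.ofReal_le_ofReal htail
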